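/- Model. Let $G=(V,E)$ be an undirected simple graph on the $n$ labelled vertices $0,\dots,n-1$ with at least one edge. Every edge is considered in both orientations: $E$ is the set of oriented edges, $m=|E|=\sum_v d(v)$ and $d_{avg}=m/n$. In the adjacency-list query model an algorithm accesses $G$ by uniform vertex queries (the answer is a uniformly random vertex), degree queries (the answer to $v$ is $d(v)$) and neighbor queries (the answer to $(v,i)$ is the $i$-th neighbor of $v$ in an arbitrary fixed ordering, or $\bot$ if there is none). A distribution $P$ on $E$ is pointwise $\eta$-close to uniform if $|P(e)-1/m|\le \eta/m$ for all $e\in E$. Theorem. There are a preprocessing procedure, a sampling procedure and an absolute constant $C>0$ such that the following holds for all $n$, all such graphs $G$ with all orderings of their adjacency lists, every approximation parameter $\varepsilon\in(0,1/2)$, failure parameter $\delta\in(0,1)$ and trade-off parameter $x>1$. (1) The preprocessing procedure, given $n,\varepsilon,\delta,x$ and query access to $G$, makes an expected number of at most $$C\cdot\max\left\{\frac{n}{d_{avg}\,x},\ \sqrt{\frac{n}{d_{avg}}}\right\}\cdot\frac{\log^2(n/\delta)}{\varepsilon^{5/2}}$$ queries. It either fails, or returns a number $\bar d_{avg}$ and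 a data structure $D$ (a finite array of real numbers). (2) With probability at least $1-\delta$ the preprocessing is successful, which means that it returns a pair $(\bar d_{avg},D)$ with $(1-\varepsilon)d_{avg}\le \bar d_{avg}\le d_{avg}$ such that every call of the sampling procedure on $D$ (with fresh randomness) returns, with probability one, an oriented edge of $G$ whose distribution is pointwise $2\varepsilon$-close to uniform, and has expected query complexity and expected running time at most $C\,\bar x/\varepsilon$, where $\bar x=\min\{x,\sqrt{n/\bar d_{avg}}\}$. Here the query complexity of the preprocessing procedure is that of an adaptive randomized decision tree. The sampling procedure is one fixed finite program (independent of $n,\varepsilon,\delta,x,G$) of a random access machine with real registers and a read-only array holding $D$; each arithmetic operation, comparison, array access, uniform draw from $\{0,\dots,k-1\}$, biased coin flip and query takes one unit of time. -/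

import Mathlib

noncomputable section

/-! ## Adjacency-list access to a graph -/

/-- An adjacency-list representation of a simple graph on the vertex set `Fin n`: for every vertex
an arbitrarily ordered, repetition-free list of its neighbors. -/
structure AdjList {n : ℕ} (G : SimpleGraph (Fin n)) where
  list : Fin n → List (Fin n)
  nodup : ∀ v, (list v).Nodup
  mem_iff : ∀ v u, u ∈ list v ↔ G.Adj v u

namespace AdjList

variable {n : ℕ} {G : SimpleGraph (Fin n)}

/-- The answer to a degree query. -/
def deg (A : AdjList G) (v : Fin n) : ℕ := (A.list v).length

/-- The answer to a neighbor query: the `i`-th neighbor of `v` (counting from zero), if any. -/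
def nbr (A : AdjList G) (v : Fin n) (i : ℕ) : Option (Fin n) := (A.list v)[i]?

end AdjList

/-- The average degree `m / n`, where `m` is the number of oriented edges (darts). -/
def avgDeg {n : ℕ} (G : SimpleGraph (Fin n)) [DecidableRel G.Adj] : ℝ :=
  (Fintype.card G.Dart : ℝ) / n

/-! ## Randomized query algorithms

Query complexity is measured in the usual way: an algorithm is an adaptive randomized decision
tree, every query costs one, and internal computation and internal randomness are free. All
branches of the tree are finite, so such an algorithm always terminates. -/

/-- Randomized algorithms with adjacency-list query access to a graph on `n` vertices and results
in `α`. -/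
inductive QueryAlg (n : ℕ) (α : Type) : Type
  /-- stop with a result -/
  | ret (a : α) : QueryAlg n α
  /-- draw an internal random number, uniform in `{0, …, k}` -/
  | rand (k : ℕ) (next : Fin (k + 1) → QueryAlg n α) : QueryAlg n α
  /-- uniform vertex query -/
  | vertex (next : Fin n → QueryAlg n α) : QueryAlg n α
  /-- degree query -/
  | degree (v : Fin n) (next : ℕ → QueryAlg n α) : QueryAlg n α
  /-- neighbor query -/
  | neighbor (v : Fin n) (i : ℕ) (next : Option (Fin n) → QueryAlg n α) : QueryAlg n α

namespace QueryAlg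

variable {n : ℕ} [NeZero n] {G : SimpleGraph (Fin n)} {α : Type}

/-- The distribution of the result when the queries are answered according to `A`. -/
def output (A : AdjList G) : QueryAlg n α → PMF α
  | ret a => PMF.pure a
  | rand k next => (PMF.uniformOfFintype (Fin (k + 1))).bind fun i => output A (next i)
  | vertex next => (PMF.uniformOfFintype (Fin n)).bind fun v => output A (next v)
  | degree v next => output A (next (A.deg v))
  | neighbor v i next => output A (next (A.nbr v i))

/-- The expected number of queries when the queries are answered according to `A`. -/
def expectedQueries (A : AdjList G) : QueryAlg n α → ENNReal
  | ret _ => 0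
  | rand k next =>
      ∑' i, PMF.uniformOfFintype (Fin (k + 1)) i * expectedQueries A (next i)
  | vertex next =>
      1 + ∑' v, PMF.uniformOfFintype (Fin n) v * expectedQueries A (next v)
  | degree v next => 1 + expectedQueries A (next (A.deg v))
  | neighbor v i next => 1 + expectedQueries A (next (A.nbr v i))

end QueryAlg

/-! ## A random access machine with graph queries

The machine has real-valued registers (initially zero) and a read-only data array, which is the
data structure that it is started on. Every instruction takes one unit of time. Vertices are
represented by their labels `0, …, n - 1`. -/

inductive ArithOp
  | add
  | sub
  | mul
  | div

def ArithOp.eval : ArithOp → ℝ → ℝ → ℝ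
  | add, a, b => a + b
  | sub, a, b => a - b
  | mul, a, b => a * b
  | div, a, b => a / b

/-- Instructions; all arguments named `dst`, `a`, `b` are register numbers. -/
inductive Instr
  /-- `dst := k` -/
  | const (dst : ℕ) (k : ℕ)
  /-- `dst := a ∘ b` for an arithmetic operation `∘` -/
  | arith (o : ArithOp) (dst a b : ℕ)
  /-- `dst :=` the entry of the data array at the address in register `a` -/
  | load (dst a : ℕ)
  /-- go to instruction number `target` if `a < b` -/
  | jumpLt (a b target : ℕ)
  /-- `dst :=` a uniform element of `{0, …, k - 1}`, where `k` is the content of `a`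
  (and `dst := 0` if `k` is zero) -/
  | rand (dst a : ℕ)
  /-- `dst := 1` with the probability in register `a` (truncated to `[0, 1]`), else `dst := 0` -/
  | coin (dst a : ℕ)
  /-- uniform vertex query, `dst :=` the label of the answer -/
  | vertex (dst : ℕ)
  /-- degree query, `dst :=` the degree of vertex `a` (`dst := -1` if `a` is no label) -/
  | degree (dst a : ℕ)
  /-- neighbor query, `dst :=` the label of neighbor number `b` of vertex `a`
  (`dst := -1` if there is none) -/
  | neighbor (dst a b : ℕ)

/-- The instructions that are queries. -/
def Instr.IsQuery : Instr → Prop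
  | vertex _ => True
  | degree _ _ => True
  | neighbor _ _ _ => True
  | _ => False

/-- A program is a finite list of instructions; it halts when the program counter leaves it. -/
abbrev Program := List Instr

/-- A machine configuration: the program counter and the contents of the registers. -/
structure Config where
  pc : ℕ
  reg : ℕ → ℝ

namespace Config

/-- Write `r` to register `dst` and go on to the next instruction. -/
def write (c : Config) (dst : ℕ) (r : ℝ) : Config :=
  ⟨c.pc + 1, Function.update c.reg dst r⟩

def init : Config := ⟨0, fun _ => 0⟩

end Config

namespace Instr

variable {n : ℕ} [NeZero n] {G : SimpleGraph (Fin n)}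

/-- The number in register `a`, read as a natural number (a memory address, a label, …). -/
def natReg (c : Config) (a : ℕ) : ℕ := ⌊c.reg a⌋₊

/-- The degree of the vertex with label `v`, or `-1`. -/
def degAnswer (A : AdjList G) (v : ℕ) : ℝ :=
  if h : v < n then (A.deg ⟨v, h⟩ : ℝ) else -1

/-- The label of the `i`-th neighbor of the vertex with label `v`, or `-1`. -/
def nbrAnswer (A : AdjList G) (v i : ℕ) : ℝ :=
  if h : v < n then
    match A.nbr ⟨v, h⟩ i with
    | some u => ((u : ℕ) : ℝ)
    | none => -1
  else -1

/-- A coin flip with success probability `p`, truncated to `[0, 1]`. -/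
def flip (p : ℝ) : PMF Bool :=
  PMF.ofFintype
    (fun b => if b then ((min 1 p.toNNReal : NNReal) : ENNReal)
      else ((1 - min 1 p.toNNReal : NNReal) : ENNReal))
    (by
      rw [Fintype.sum_bool]
      simp only [if_true, Bool.false_eq_true, if_false]
      rw [← ENNReal.coe_add, add_tsub_cancel_of_le (min_le_left _ _), ENNReal.coe_one])

/-- The (random) effect of one instruction, with query answers according to `A` and data array
`D`. -/
def exec (A : AdjList G) (D : List ℝ) (c : Config) : Instr → PMF Config
  | const dst k => PMF.pure (c.write dst k)
  | arith o dst a b => PMF.pure (c.write dst (o.eval (c.reg a) (c.reg b)))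
  | load dst a => PMF.pure (c.write dst (D.getD (natReg c a) 0))
  | jumpLt a b target =>
      PMF.pure (if c.reg a < c.reg b then ⟨target, c.reg⟩ else ⟨c.pc + 1, c.reg⟩)
  | rand dst a =>
      (PMF.uniformOfFintype (Fin (natReg c a - 1 + 1))).map fun i => c.write dst ((i : ℕ) : ℝ)
  | coin dst a =>
      (flip (c.reg a)).map fun b => c.write dst (if b then 1 else 0)
  | vertex dst => (PMF.uniformOfFintype (Fin n)).map fun v => c.write dst ((v : ℕ) : ℝ)
  | degree dst a => PMF.pure (c.write dst (degAnswer A (natReg c a)))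
  | neighbor dst a b => PMF.pure (c.write dst (nbrAnswer A (natReg c a) (natReg c b)))

end Instr

namespace Program

variable {n : ℕ} [NeZero n] {G : SimpleGraph (Fin n)}

def Halted (p : Program) (c : Config) : Prop := p[c.pc]? = none

/-- One step of the machine; a halted configuration does not change. -/
def step (p : Program) (A : AdjList G) (D : List ℝ) (c : Config) : PMF Config :=
  match p[c.pc]? with
  | none => PMF.pure c
  | some I => I.exec A D c

/-- The distribution of the configuration after `t` steps. -/
def run (p : Program) (A : AdjList G) (D : List ℝ) : ℕ → PMF Config
  | 0 => PMF.pure Config.init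
  | t + 1 => (run p A D t).bind (step p A D)

/-- The expected number of steps until the program halts (infinite if it need not halt). -/
def expectedTime (p : Program) (A : AdjList G) (D : List ℝ) : ENNReal :=
  ∑' t, (p.run A D t).toOuterMeasure {c | ¬ p.Halted c}

/-- The expected number of queries that the program makes. -/
def expectedQueries (p : Program) (A : AdjList G) (D : List ℝ) : ENNReal :=
  ∑' t, (p.run A D t).toOuterMeasure {c | ∃ I, p[c.pc]? = some I ∧ I.IsQuery}

/-- The probability that the program halts and returns the oriented edge `e`; the edge is returned
as the labels of its two endpoints in registers `0` and `1`. -/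
def returnProb (p : Program) (A : AdjList G) (D : List ℝ) (e : G.Dart) : ENNReal :=
  ⨆ t, (p.run A D t).toOuterMeasure
    {c | p.Halted c ∧ c.reg 0 = ((e.fst : ℕ) : ℝ) ∧ c.reg 1 = ((e.snd : ℕ) : ℝ)}

end Program

/-! ## Guarantees -/

/-- `P` is pointwise `ε`-close to `Q`. -/
def PointwiseClose {Ω : Type*} (P Q : PMF Ω) (ε : ℝ) : Prop :=
  ∀ ω, |(P ω).toReal - (Q ω).toReal| ≤ ε * (Q ω).toReal

/-- The preprocessing was successful with result `o`: it did not fail, but returned an estimate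
`d` with `(1 - ε) * davg ≤ d ≤ davg` of the average degree and a data structure `D`, such that a
call of the sampling procedure `samp` on `D` returns an oriented edge (with probability one) whose
distribution is pointwise `2 * ε`-close to uniform, and makes an expected number of at most
`C * xbar / ε` queries and steps, where `xbar = min x √(n / d)`. -/
def Successful {n : ℕ} [NeZero n] {G : SimpleGraph (Fin n)} [DecidableRel G.Adj]
    [Nonempty G.Dart] (A : AdjList G) (samp : Program) (C ε x : ℝ) :
    Option (ℝ × List ℝ) → Prop
  | none => False
  | some (d, D) =>
      ((1 - ε) * avgDeg G ≤ d ∧ d ≤ avgDeg G) ∧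
      (∃ P : PMF G.Dart, (∀ e, samp.returnProb A D e = P e) ∧
        PointwiseClose P (PMF.uniformOfFintype G.Dart) (2 * ε)) ∧
      samp.expectedQueries A D ≤ ENNReal.ofReal (C * (min x √((n : ℝ) / d) / ε)) ∧
      samp.expectedTime A D ≤ ENNReal.ofReal (C * (min x √((n : ℝ) / d) / ε))

end

/-! The sampler is a rejection scheme with a degree threshold `Θ = x̄ d̄ / ε`. An edge with a light
tail (degree at most `Θ`) is proposed by drawing a uniform vertex `v`, keeping it with probability
`d(v)/Θ` and taking a random neighbor: every such edge has probability exactly `1/(nΘ)`. For heavy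
tails, preprocessing stores a uniform sample `S` of `s` vertices with degree sum `N`. A vertex of
`S` drawn proportionally to its degree, followed by a random neighbor `u` and, if `u` is heavy, a
random edge out of `u`, gives each edge out of `u` the probability `c(u) / (N d(u))`, where `c(u)`
counts the members of `S` adjacent to `u`. By Chernoff `c(u) ≈ s d(u)/n` for all heavy `u` at once,
so this is nearly `s/(nN)`. Choosing the heavy branch with probability `N/(Θs+N)` gives all edges
nearly the same probability `s/(n(Θs+N))` (`pass_bounds`). If `N ≤ 2Θs`, one pass succeeds with
probability of order `d_avg/Θ`, hence the time `O(x̄/ε)` (`sampling_correct`). Markov's inequality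
gives `N ≤ 2Θs` with probability one half; logarithmically many samples amplify this
(`buildData_correct`).

On the machine, this reduces to one pass: a bounded function of configurations that decreases by at
most `κ` per expected step satisfies a renewal inequality at the start of the program
(`subharmonic_le`). It yields the running time, upper bounds for every output event and, because the
program halts almost surely, the exact output law (`returnProb_eq`).

The average degree is estimated by `d(v) · weight` along a random edge out of a random vertex. Edges
between light vertices count once in each direction, edges with one heavy endpoint count twice from
the light side, and edges between heavy vertices are dropped. The variable is bounded by twice the
threshold `T`, and since there are at most `m/T` heavy vertices, at most `(m/T)²` oriented edges are
lost (`le_sum_weight`). A suitable `T` needs a guess of the average degree; guesses are halved until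
one is confirmed (`accept_or_reject`). This estimation causes the factor `ε^(-5/2)`. Bad events have
probability about `(δ/n)^10`, so even the worst-case cost contributes little to the expectation. -/

noncomputable section

open scoped ENNReal

/-! ### Expectations under discrete distributions -/

namespace PMF

variable {α β : Type*}

/-- The mean of a nonnegative function under a discrete distribution. -/
def mean (p : PMF α) (f : α → ℝ≥0∞) : ℝ≥0∞ := ∑' a, p a * f a

theorem mean_pure (a : α) (f : α → ℝ≥0∞) : (PMF.pure a).mean f = f a := by
  rw [mean, tsum_eq_single a]
  · simp
  · intro b hb; simp [PMF.pure_apply, hb]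

theorem mean_bind (p : PMF α) (q : α → PMF β) (f : β → ℝ≥0∞) :
    (p.bind q).mean f = p.mean fun a => (q a).mean f := by
  simp only [mean, PMF.bind_apply, ← ENNReal.tsum_mul_right, ← ENNReal.tsum_mul_left]
  rw [ENNReal.tsum_comm]
  simp only [mul_assoc]

theorem mean_map (p : PMF α) (g : α → β) (f : β → ℝ≥0∞) :
    (p.map g).mean f = p.mean fun a => f (g a) := by
  rw [PMF.map, mean_bind]
  simp only [Function.comp, mean_pure]

theorem mean_mono (p : PMF α) {f g : α → ℝ≥0∞} (h : ∀ a, f a ≤ g a) : p.mean f ≤ p.mean g :=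
  ENNReal.tsum_le_tsum fun a => mul_le_mul_right (h a) _

theorem mean_const (p : PMF α) (c : ℝ≥0∞) : (p.mean fun _ => c) = c := by
  rw [mean, ENNReal.tsum_mul_right, p.tsum_coe, one_mul]

theorem mean_add (p : PMF α) (f g : α → ℝ≥0∞) :
    (p.mean fun a => f a + g a) = p.mean f + p.mean g := by
  simp only [mean, mul_add, ENNReal.tsum_add]

theorem mean_const_add (p : PMF α) (c : ℝ≥0∞) (g : α → ℝ≥0∞) :
    (p.mean fun a => c + g a) = c + p.mean g := by
  rw [mean_add, mean_const]

theorem mean_const_mul (p : PMF α) (c : ℝ≥0∞) (f : α → ℝ≥0∞) :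
    (p.mean fun a => c * f a) = c * p.mean f := by
  simp only [mean, ← ENNReal.tsum_mul_left]
  exact tsum_congr fun a => mul_left_comm _ _ _

theorem mean_mul_const (p : PMF α) (c : ℝ≥0∞) (f : α → ℝ≥0∞) :
    (p.mean fun a => f a * c) = p.mean f * c := by
  simp only [mul_comm _ c, mean_const_mul]

theorem mean_sum {ι : Type*} (p : PMF α) (s : Finset ι) (f : ι → α → ℝ≥0∞) :
    (p.mean fun a => ∑ i ∈ s, f i a) = ∑ i ∈ s, p.mean (f i) := by
  simp only [mean, Finset.mul_sum]
  exact Summable.tsum_finsetSum fun _ _ => ENNReal.summable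

theorem mean_le_of_le (p : PMF α) {f : α → ℝ≥0∞} {c : ℝ≥0∞} (h : ∀ a, f a ≤ c) : p.mean f ≤ c :=
  (p.mean_mono h).trans (p.mean_const c).le

theorem toOuterMeasure_eq_mean (p : PMF α) (s : Set α) :
    p.toOuterMeasure s = p.mean (s.indicator 1) := by
  rw [PMF.toOuterMeasure_apply, mean]
  refine tsum_congr fun a => ?_
  by_cases h : a ∈ s <;> simp [h]

theorem mean_fintype [Fintype α] (p : PMF α) (f : α → ℝ≥0∞) : p.mean f = ∑ a, p a * f a :=
  tsum_fintype _

theorem mean_uniform [Fintype α] [Nonempty α] (f : α → ℝ≥0∞) :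
    (PMF.uniformOfFintype α).mean f = (Fintype.card α : ℝ≥0∞)⁻¹ * ∑ a, f a := by
  simp [mean_fintype, Finset.mul_sum]

theorem mean_single [DecidableEq α] (p : PMF α) (a : α) :
    (p.mean fun b => if b = a then 1 else 0) = p a := by
  rw [mean, tsum_eq_single a]
  · simp
  · intro b hb; simp [hb]

end PMF

/-! ### Machine runs as iterates of a one-step expectation operator -/

namespace Instr

variable {n : ℕ} [NeZero n] {G : SimpleGraph (Fin n)} (A : AdjList G) (D : List ℝ) (c : Config)

theorem mean_exec_rand (dst a : ℕ) {k : ℕ} (h : c.reg a = k) (f : Config → ℝ≥0∞) :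
    (exec A D c (.rand dst a)).mean f =
      (PMF.uniformOfFintype (Fin (k - 1 + 1))).mean fun i => f (c.write dst ((i : ℕ) : ℝ)) := by
  obtain rfl : natReg c a = k := by rw [natReg, h, Nat.floor_natCast]
  rw [exec, PMF.mean_map]
  exact PMF.mean_map _ _ _

theorem mean_exec_vertex (dst : ℕ) (f : Config → ℝ≥0∞) :
    (exec A D c (.vertex dst)).mean f =
      (PMF.uniformOfFintype (Fin n)).mean fun v => f (c.write dst ((v : ℕ) : ℝ)) := by
  rw [exec, PMF.mean_map]
  exact PMF.mean_map _ _ _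

theorem mean_exec_coin (dst a : ℕ) (f : Config → ℝ≥0∞) :
    (exec A D c (.coin dst a)).mean f =
      (flip (c.reg a)).mean fun b => f (c.write dst (if b then 1 else 0)) := by
  rw [exec, PMF.mean_map]

end Instr

namespace Program

variable {n : ℕ} [NeZero n] {G : SimpleGraph (Fin n)}

/-- The mean of `f` after one step from a given configuration. -/
def next (p : Program) (A : AdjList G) (D : List ℝ) (f : Config → ℝ≥0∞) (c : Config) : ℝ≥0∞ :=
  (p.step A D c).mean f

variable (p : Program) (A : AdjList G) (D : List ℝ)

theorem next_mono {f g : Config → ℝ≥0∞} (h : f ≤ g) : p.next A D f ≤ p.next A D g :=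
  fun _ => PMF.mean_mono _ h

theorem next_halted (f : Config → ℝ≥0∞) {c : Config} (h : p.Halted c) : p.next A D f c = f c := by
  unfold Halted at h
  simp only [next, step, h, PMF.mean_pure]

theorem next_some (f : Config → ℝ≥0∞) {c : Config} {I : Instr} (h : p[c.pc]? = some I) :
    p.next A D f c = (I.exec A D c).mean f := by
  simp only [next, step, h]

theorem iterate_next_halted (f : Config → ℝ≥0∞) {c : Config} (h : p.Halted c) (t : ℕ) :
    (p.next A D)^[t] f c = f c := by
  induction t with
  | zero => rfl
  | succ t ih => rw [Function.iterate_succ_apply', next_halted _ _ _ _ h, ih]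

/-- Passing from distributions to functions lets a run be analysed from an arbitrary configuration,
as restarts require. -/
theorem mean_run (t : ℕ) (f : Config → ℝ≥0∞) :
    (p.run A D t).mean f = (p.next A D)^[t] f Config.init := by
  induction t generalizing f with
  | zero => exact PMF.mean_pure _ _
  | succ t ih =>
    rw [run, PMF.mean_bind, Function.iterate_succ_apply, ← ih]
    rfl

theorem iterate_next_mono {f g : Config → ℝ≥0∞} (h : f ≤ g) (t : ℕ) :
    (p.next A D)^[t] f ≤ (p.next A D)^[t] g := by
  induction t with
  | zero => exact h
  | succ t ih =>
    rw [Function.iterate_succ_apply', Function.iterate_succ_apply']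
    exact next_mono _ _ _ ih

theorem iterate_next_le_succ {f : Config → ℝ≥0∞} (h : f ≤ p.next A D f) (t : ℕ) :
    (p.next A D)^[t] f ≤ p.next A D ((p.next A D)^[t] f) := by
  have := iterate_next_mono p A D h t
  rwa [← Function.iterate_succ_apply, Function.iterate_succ_apply'] at this

/-- The indicator of the halted configurations in a set never decreases on average. -/
theorem indicator_halted_le_next (s : Set Config) :
    ({c | p.Halted c ∧ c ∈ s}.indicator 1 : Config → ℝ≥0∞) ≤
      p.next A D ({c | p.Halted c ∧ c ∈ s}.indicator 1) := by
  intro c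
  by_cases h : p.Halted c
  · rw [next_halted _ _ _ _ h]
  · rw [Set.indicator_of_notMem]
    · exact zero_le
    · exact fun hc => h hc.1

/-- The expected number of steps among the first `t`, from a given configuration. -/
def timeUpTo (t : ℕ) (c : Config) : ℝ≥0∞ :=
  ∑ i ∈ Finset.range t, (p.next A D)^[i] ({c | ¬ p.Halted c}.indicator 1) c

theorem timeUpTo_succ (t : ℕ) (c : Config) :
    p.timeUpTo A D (t + 1) c =
      ({c | ¬ p.Halted c}.indicator 1 c : ℝ≥0∞) + p.next A D (p.timeUpTo A D t) c := by
  rw [timeUpTo, Finset.sum_range_succ']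
  simp only [Function.iterate_succ_apply', Function.iterate_zero, id]
  rw [add_comm]
  congr 1
  exact (PMF.mean_sum _ _ _).symm

/-- First-step analysis, in the form that `subharmonic_le` takes with `κ = 1`. Truncation at `t`
keeps the function bounded. -/
theorem timeUpTo_le_next (t : ℕ) (c : Config) :
    p.timeUpTo A D t c ≤ 1 + p.next A D (p.timeUpTo A D t) c := by
  calc p.timeUpTo A D t c ≤ p.timeUpTo A D (t + 1) c :=
        Finset.sum_le_sum_of_subset (Finset.range_subset_range.2 t.le_succ)
    _ ≤ _ := by
        rw [timeUpTo_succ]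
        gcongr
        exact Set.indicator_le_self' (fun _ _ => zero_le) c

theorem timeUpTo_halted (t : ℕ) {c : Config} (h : p.Halted c) : p.timeUpTo A D t c = 0 := by
  refine Finset.sum_eq_zero fun i _ => ?_
  rw [iterate_next_halted _ _ _ _ h]
  simp [h]

theorem timeUpTo_le (t : ℕ) (c : Config) : p.timeUpTo A D t c ≤ t := by
  have : ∀ i, (p.next A D)^[i] ({c | ¬ p.Halted c}.indicator 1) c ≤ 1 := by
    intro i
    induction i generalizing c with
    | zero => exact Set.indicator_le_self' (fun _ _ => zero_le) c
    | succ i ih =>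
      rw [Function.iterate_succ_apply']
      exact PMF.mean_le_of_le _ ih
  calc p.timeUpTo A D t c ≤ ∑ _i ∈ Finset.range t, 1 := Finset.sum_le_sum fun i _ => this i
    _ = t := by simp

theorem expectedTime_eq_iSup :
    p.expectedTime A D = ⨆ t, p.timeUpTo A D t Config.init := by
  rw [expectedTime, ENNReal.tsum_eq_iSup_nat]
  simp only [PMF.toOuterMeasure_eq_mean, mean_run, timeUpTo]

theorem expectedQueries_le_expectedTime : p.expectedQueries A D ≤ p.expectedTime A D := by
  refine ENNReal.tsum_le_tsum fun t => (p.run A D t).toOuterMeasure.mono ?_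
  rintro c ⟨I, hI, -⟩ hc
  rw [Halted, hI] at hc
  exact Option.some_ne_none _ hc

end Program

/-! ### The sampling program and the law of one pass -/

namespace EdgeSampler

/-- The sampling procedure. Its data array holds the probability `β` of the second branch, the
degree threshold `Θ`, the length of a list of vertices, and that list. The first branch tries to
return an edge with a tail of degree at most `Θ`; the second branch walks to a random neighbor of
a random vertex from the list, and returns a random edge from there if its degree exceeds `Θ`. A
branch that fails restarts the procedure. -/
def program : Program :=
  -- Registers 2, 4, 6 hold the constants 0, 1, 2, which also serve as addresses; registers 3, 5, 7
  -- receive `β`, `Θ` and the list length. The light branch starts at 8, the heavy one at 15, and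
  -- the common last draw at 26. Jumps to 0 restart; the program halts at 29.
  [.const 2 0, .load 3 2, .const 4 1, .load 5 4, .const 6 2, .load 7 6,
   .coin 8 3, .jumpLt 2 8 15,
   .vertex 0, .degree 9 0, .jumpLt 5 9 0, .arith .div 8 9 5, .coin 8 8, .jumpLt 2 8 26,
   .jumpLt 2 4 0,
   .rand 8 7, .const 10 3, .arith .add 8 8 10, .load 1 8, .degree 9 1, .rand 8 9,
   .neighbor 0 1 8, .jumpLt 0 2 0, .degree 9 0, .jumpLt 5 9 26, .jumpLt 2 4 0,
   .rand 8 9, .neighbor 1 0 8, .jumpLt 1 2 0]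

/-- The data array of the sampling procedure. -/
def data {n : ℕ} (β Θ : ℝ) (W : List (Fin n)) : List ℝ :=
  β :: Θ :: (W.length : ℝ) :: W.map fun v : Fin n => ((v : ℕ) : ℝ)

variable {n : ℕ} [NeZero n] {G : SimpleGraph (Fin n)}

variable (A : AdjList G)

/-- The oriented edge from `v` to its `i`-th neighbor. -/
def dart (v : Fin n) (i : ℕ) : Option G.Dart :=
  if h : i < A.deg v then
    some ⟨(v, (A.list v)[i]'h), (A.mem_iff _ _).1 (List.getElem_mem h)⟩
  else none

/-- A uniformly random edge out of `v`, if there is one. -/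
def pick (v : Fin n) : PMF (Option G.Dart) :=
  (PMF.uniformOfFintype (Fin (A.deg v - 1 + 1))).map fun i : Fin _ => dart A v i

/-- Continue with an edge, if there is one. -/
def andThen (p : PMF (Option G.Dart)) (f : G.Dart → PMF (Option G.Dart)) :
    PMF (Option G.Dart) :=
  p.bind fun o => o.elim (PMF.pure none) f

open Classical in
/-- The result of the first branch. -/
def lightBranch (Θ : ℝ) : PMF (Option G.Dart) :=
  (PMF.uniformOfFintype (Fin n)).bind fun v =>
    if Θ < A.deg v then PMF.pure none
    else (Instr.flip (A.deg v / Θ)).bind fun b => if b then pick A v else PMF.pure none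

open Classical in
/-- The result of the second branch. -/
def heavyBranch (Θ : ℝ) (W : List (Fin n)) : PMF (Option G.Dart) :=
  (PMF.uniformOfFintype (Fin (W.length - 1 + 1))).bind fun i =>
    andThen (pick A (W.getD i 0)) fun e =>
      if Θ < A.deg e.snd then pick A e.snd else PMF.pure none

/-- The result of one pass of the sampling procedure. -/
def pass (β Θ : ℝ) (W : List (Fin n)) : PMF (Option G.Dart) :=
  (Instr.flip β).bind fun b => if b then heavyBranch A Θ W else lightBranch A Θ

variable {A} {β Θ : ℝ} {W : List (Fin n)} {F : Config → ℝ≥0∞} {κ : ℝ≥0∞}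
  {φ : Option G.Dart → ℝ≥0∞}

/-- The rule for symbolic execution: each instruction adds one `κ` to the bound, and `F` is pushed
to the successor. -/
theorem step_le (hF : ∀ c, ¬ program.Halted c → F c ≤ κ + program.next A (data β Θ W) F c)
    (c : Config) (I : Instr) (h : program[c.pc]? = some I) {V : ℝ≥0∞} {k : ℕ}
    (hV : (I.exec A (data β Θ W) c).mean F ≤ k * κ + V) :
    F c ≤ ((k + 1 : ℕ) : ℝ≥0∞) * κ + V := by
  refine (hF c (by simp [Program.Halted, h])).trans ?_
  rw [Program.next_some _ _ _ _ h]
  calc κ + _ ≤ κ + (k * κ + V) := by gcongr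
    _ = _ := by push_cast; ring

omit [NeZero n] in
theorem nbrAnswer_eq (v : Fin n) (i : ℕ) :
    Instr.nbrAnswer A (v : ℕ) i = (dart A v i).elim (-1) fun e => ((e.snd : ℕ) : ℝ) := by
  unfold Instr.nbrAnswer dart AdjList.nbr
  by_cases h : i < A.deg v
  · have h' : i < (A.list v).length := h
    simp only [h, h', Fin.is_lt, Fin.eta, dite_true, List.getElem?_eq_getElem, Option.elim_some]
    rfl
  · have h' : ¬ i < (A.list v).length := h
    simp [h, List.getElem?_eq_none (not_lt.1 h')]

omit [NeZero n] in
theorem degAnswer_eq (v : Fin n) : Instr.degAnswer A (v : ℕ) = A.deg v := by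
  simp [Instr.degAnswer]

omit [NeZero n] in
theorem dart_fst {v : Fin n} {i : ℕ} {e : G.Dart} (h : dart A v i = some e) : e.fst = v := by
  unfold dart at h
  split at h
  · cases h; rfl
  · cases h

section

variable (hF : ∀ c, ¬ program.Halted c → F c ≤ κ + program.next A (data β Θ W) F c)
  (h0 : ∀ r, F ⟨0, r⟩ ≤ φ none)
  (h1 : ∀ r (e : G.Dart), r 0 = ((e.fst : ℕ) : ℝ) → r 1 = ((e.snd : ℕ) : ℝ) →
    F ⟨29, r⟩ ≤ φ (some e))

-- The last draw is shared by both branches. `h0` covers all register contents because a restart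
-- does not clear them.
include hF h0 h1 in
theorem tail_le (r : ℕ → ℝ) (v : Fin n) (hv : r 0 = ((v : ℕ) : ℝ)) (hd : r 9 = A.deg v)
    (hr : r 2 = 0) : F ⟨26, r⟩ ≤ (3 : ℕ) * κ + (pick A v).mean φ := by
  refine step_le hF _ (.rand 8 9) rfl ?_
  rw [Instr.mean_exec_rand _ _ _ _ _ hd, pick, PMF.mean_map, ← PMF.mean_const_add]
  refine PMF.mean_mono _ fun i => ?_
  refine step_le hF _ (.neighbor 1 0 8) rfl ?_
  simp only [Instr.exec, PMF.mean_pure, Instr.natReg, Config.write, Function.update_self, hv,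
    Nat.floor_natCast, ne_eq, OfNat.zero_ne_ofNat, not_false_eq_true,
    Function.update_of_ne, nbrAnswer_eq]
  refine step_le (k := 0) hF _ (.jumpLt 1 2 0) rfl ?_
  cases h : dart A v i with
  -- Only a vertex of degree zero leads here: the drawn index is then 0, the answer is `-1`, and the
  -- program restarts.
  | none => simpa [Instr.exec, PMF.mean_pure, h, hr] using h0 _
  | some e =>
    have : ¬ (((e.snd : ℕ) : ℝ) < 0) := by simp
    simp only [Instr.exec, PMF.mean_pure]
    simpa [h, hr, this] using h1 _ e (by simp [hv, dart_fst h]) (by simp)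

include hF h0 in
theorem restart_le (r : ℕ → ℝ) (k : ℕ) (hk : k = 14 ∨ k = 25) (h2 : r 2 = 0) (h4 : r 4 = 1) :
    F ⟨k, r⟩ ≤ (1 : ℕ) * κ + φ none := by
  obtain rfl | rfl := hk
  all_goals
    -- The comparison `0 < 1` acts as an unconditional jump.
    refine step_le (k := 0) hF _ (.jumpLt 2 4 0) rfl ?_
    simpa [Instr.exec, PMF.mean_pure, h2, h4] using h0 _

include hF h0 h1 in
theorem light_le (r : ℕ → ℝ) (h2 : r 2 = 0) (h4 : r 4 = 1) (h5 : r 5 = Θ) :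
    F ⟨8, r⟩ ≤ (9 : ℕ) * κ + (lightBranch A Θ).mean φ := by
  refine step_le hF _ (.vertex 0) rfl ?_
  rw [Instr.mean_exec_vertex, lightBranch, PMF.mean_bind, ← PMF.mean_const_add]
  refine PMF.mean_mono _ fun v => ?_
  refine step_le hF _ (.degree 9 0) rfl ?_
  simp only [Instr.exec, PMF.mean_pure, Instr.natReg, Config.write, Function.update_self,
    Nat.floor_natCast, degAnswer_eq]
  refine step_le hF _ (.jumpLt 5 9 0) rfl ?_
  simp only [Instr.exec, PMF.mean_pure]
  by_cases hv : Θ < A.deg v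
  · simpa [hv, h5, PMF.mean_pure] using le_add_left (h0 _)
  simp only [hv, h5, ne_eq, Nat.reduceEqDiff, not_false_eq_true, Function.update_of_ne,
    Function.update_self, OfNat.ofNat_ne_zero, if_false]
  refine step_le hF _ (.arith .div 8 9 5) rfl ?_
  simp only [Instr.exec, PMF.mean_pure, Config.write, ArithOp.eval]
  refine step_le hF _ (.coin 8 8) rfl ?_
  rw [Instr.mean_exec_coin, PMF.mean_bind, ← PMF.mean_const_add]
  simp only [h5, ne_eq, Nat.reduceEqDiff, not_false_eq_true, Function.update_of_ne,
    Function.update_self, OfNat.ofNat_ne_zero]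
  refine PMF.mean_mono _ fun b => ?_
  refine step_le hF _ (.jumpLt 2 8 26) rfl ?_
  cases b with
  | true =>
    simpa [Instr.exec, PMF.mean_pure, Config.write, h2] using
      tail_le hF h0 h1 _ v (by simp) (by simp) (by simp [h2])
  | false =>
    simp only [Instr.exec, PMF.mean_pure, Config.write]
    simp only [h2, ne_eq, Nat.reduceEqDiff, not_false_eq_true, Function.update_of_ne,
      Function.update_self, OfNat.ofNat_ne_zero, if_false, Bool.false_eq_true, lt_irrefl, PMF.mean_pure]
    refine (restart_le hF h0 _ 14 (Or.inl rfl) (by simp [h2]) (by simp [h4])).trans ?_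
    gcongr
    norm_num

include hF h0 h1 in
theorem heavy_le (r : ℕ → ℝ) (h2 : r 2 = 0) (h4 : r 4 = 1) (h5 : r 5 = Θ)
    (h7 : r 7 = W.length) :
    F ⟨15, r⟩ ≤ (13 : ℕ) * κ + (heavyBranch A Θ W).mean φ := by
  refine step_le hF _ (.rand 8 7) rfl ?_
  rw [Instr.mean_exec_rand _ _ _ _ _ h7, heavyBranch, PMF.mean_bind, ← PMF.mean_const_add]
  refine PMF.mean_mono _ fun i => ?_
  refine step_le hF _ (.const 10 3) rfl ?_
  simp only [Instr.exec, PMF.mean_pure, Config.write]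
  refine step_le hF _ (.arith .add 8 8 10) rfl ?_
  simp only [Instr.exec, PMF.mean_pure, Config.write, ArithOp.eval]
  refine step_le hF _ (.load 1 8) rfl ?_
  -- The vertex list begins at address 3. Both sides default to vertex 0 out of range, so this also
  -- holds for an empty list.
  have hload : (data β Θ W).getD ⌊((i : ℕ) : ℝ) + 3⌋₊ 0 = ((W.getD i 0 : Fin n) : ℕ) := by
    have : ⌊((i : ℕ) : ℝ) + 3⌋₊ = i + 3 := by
      exact_mod_cast Nat.floor_natCast (R := ℝ) ((i : ℕ) + 3)
    rw [this]
    simp only [data, List.getD_cons_succ]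
    by_cases hi : (i : ℕ) < W.length <;> simp [List.getD_eq_getElem?_getD, hi]
  simp only [Instr.exec, PMF.mean_pure, Config.write, Instr.natReg, ne_eq, Nat.reduceEqDiff,
    not_false_eq_true, Function.update_of_ne, Function.update_self, Nat.cast_ofNat, hload]
  set v := W.getD i 0
  refine step_le hF _ (.degree 9 1) rfl ?_
  simp only [Instr.exec, PMF.mean_pure, Instr.natReg, Config.write, Function.update_self,
    Nat.floor_natCast, degAnswer_eq]
  refine step_le hF _ (.rand 8 9) rfl ?_
  rw [Instr.mean_exec_rand _ _ _ _ _ (k := A.deg v) (by simp), andThen, PMF.mean_bind, pick,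
    PMF.mean_map, ← PMF.mean_const_add]
  refine PMF.mean_mono _ fun j => ?_
  refine step_le hF _ (.neighbor 0 1 8) rfl ?_
  simp only [Instr.exec, PMF.mean_pure, Instr.natReg, Config.write, Function.update_self,
    Nat.floor_natCast, ne_eq, OfNat.one_ne_ofNat,
    not_false_eq_true, Function.update_of_ne, nbrAnswer_eq]
  refine step_le hF _ (.jumpLt 0 2 0) rfl ?_
  cases h : dart A v j with
  | none => simpa [Instr.exec, PMF.mean_pure, h, h2] using le_add_left (h0 _)
  | some e =>
    have : ¬ (((e.snd : ℕ) : ℝ) < 0) := by simp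
    simp only [Instr.exec, PMF.mean_pure]
    simp only [h2, this, ne_eq, OfNat.ofNat_ne_zero, Nat.reduceEqDiff, OfNat.ofNat_ne_one,
      not_false_eq_true, Function.update_of_ne, Function.update_self, Option.elim_some, if_false]
    refine step_le hF _ (.degree 9 0) rfl ?_
    simp only [Instr.exec, PMF.mean_pure, Instr.natReg, Config.write, Function.update_self,
      Nat.floor_natCast, degAnswer_eq]
    refine step_le hF _ (.jumpLt 5 9 26) rfl ?_
    simp only [Instr.exec, PMF.mean_pure]
    by_cases hu : Θ < A.deg e.snd
    · simpa [hu, h5, h2] using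
        tail_le hF h0 h1 _ e.snd (by simp) (by simp) (by simp [h2])
    · simp only [hu, h5, ne_eq, OfNat.ofNat_ne_zero, Nat.reduceEqDiff, OfNat.ofNat_ne_one,
        not_false_eq_true, Function.update_of_ne, Function.update_self, if_false, PMF.mean_pure]
      refine (restart_le hF h0 _ 25 (Or.inr rfl) (by simp [h2]) (by simp [h4])).trans ?_
      gcongr
      norm_num

-- The 21 consists of eight initial instructions and at most 13 in the longer, heavy branch.
include hF h0 h1 in
theorem start_le (r : ℕ → ℝ) :
    F ⟨0, r⟩ ≤ (21 : ℕ) * κ + (pass A β Θ W).mean φ := by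
  refine step_le hF _ (.const 2 0) rfl ?_
  simp only [Instr.exec, PMF.mean_pure, Config.write]
  refine step_le hF _ (.load 3 2) rfl ?_
  simp only [Instr.exec, PMF.mean_pure, Config.write]
  refine step_le hF _ (.const 4 1) rfl ?_
  simp only [Instr.exec, PMF.mean_pure, Config.write]
  refine step_le hF _ (.load 5 4) rfl ?_
  simp only [Instr.exec, PMF.mean_pure, Config.write]
  refine step_le hF _ (.const 6 2) rfl ?_
  simp only [Instr.exec, PMF.mean_pure, Config.write]
  refine step_le hF _ (.load 7 6) rfl ?_
  simp only [Instr.exec, PMF.mean_pure, Config.write]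
  refine step_le hF _ (.coin 8 3) rfl ?_
  rw [Instr.mean_exec_coin, pass, PMF.mean_bind, ← PMF.mean_const_add]
  simp only [Instr.natReg, data, ne_eq, Nat.reduceEqDiff, not_false_eq_true,
    Function.update_of_ne, Function.update_self, Nat.floor_natCast, List.getD_cons_succ,
    List.getD_cons_zero]
  refine PMF.mean_mono _ fun b => ?_
  refine step_le hF _ (.jumpLt 2 8 15) rfl ?_
  cases b with
  | true =>
    simp only [Instr.exec, PMF.mean_pure, Config.write]
    simp only [ne_eq, Nat.reduceEqDiff, not_false_eq_true, Function.update_of_ne,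
      Function.update_self, if_true, Nat.cast_zero, zero_lt_one]
    exact heavy_le hF h0 h1 _ (by simp) (by simp) (by simp) (by simp)
  | false =>
    simp only [Instr.exec, PMF.mean_pure, Config.write]
    simp only [ne_eq, Nat.reduceEqDiff, not_false_eq_true, Function.update_of_ne,
      Function.update_self, if_false, Bool.false_eq_true, Nat.cast_zero, lt_irrefl]
    refine (light_le hF h0 h1 _ (by simp) (by simp) (by simp)).trans ?_
    gcongr
    norm_num

end

end EdgeSampler

/-! ### Running time and output law from one pass -/

namespace EdgeSampler

variable {n : ℕ} [NeZero n] {G : SimpleGraph (Fin n)} [DecidableRel G.Adj] {A : AdjList G}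
  {β Θ : ℝ} {W : List (Fin n)}

variable (A β Θ W) in
/-- The probability that one pass of the sampling procedure returns an edge. -/
def passProb : ℝ≥0∞ := ∑ e : G.Dart, pass A β Θ W (some e)

theorem pass_none_add : pass A β Θ W none + passProb A β Θ W = 1 := by
  rw [passProb, ← Fintype.sum_option, ← tsum_fintype (L := .unconditional _), PMF.tsum_coe]

theorem passProb_ne_top : passProb A β Θ W ≠ ⊤ := fun h => by
  simpa [h] using pass_none_add (A := A) (β := β) (Θ := Θ) (W := W)

/-- Renewal argument: one pass either returns an edge or leads back to the start, so the supremum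
`M` at the start satisfies `M ≤ 21κ + ∑ pass(e) ψ(e) + pass(none) M`. Boundedness of `F` makes `M`
finite, so that the last term can be cancelled. -/
theorem subharmonic_le {F : Config → ℝ≥0∞} {κ B : ℝ≥0∞} {ψ : G.Dart → ℝ≥0∞}
    (hpos : passProb A β Θ W ≠ 0)
    (hF : ∀ c, ¬ program.Halted c → F c ≤ κ + program.next A (data β Θ W) F c)
    (hB : B ≠ ⊤) (hFB : ∀ c, F c ≤ B)
    (h1 : ∀ r (e : G.Dart), r 0 = ((e.fst : ℕ) : ℝ) → r 1 = ((e.snd : ℕ) : ℝ) →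
      F ⟨29, r⟩ ≤ ψ e) (r : ℕ → ℝ) :
    F ⟨0, r⟩ ≤ (21 * κ + ∑ e, pass A β Θ W (some e) * ψ e) / passProb A β Θ W := by
  set M := ⨆ r, F ⟨0, r⟩
  have hM : M ≠ ⊤ := ne_top_of_le_ne_top hB (iSup_le fun r => hFB _)
  have key : M ≤ 21 * κ + ∑ e, pass A β Θ W (some e) * ψ e + pass A β Θ W none * M := by
    refine iSup_le fun r => ?_
    refine (start_le (φ := fun o => o.elim M ψ) hF (fun r => le_iSup (fun r => F ⟨0, r⟩) r) h1
      r).trans ?_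
    rw [PMF.mean_fintype, Fintype.sum_option]
    simp only [Option.elim_none, Option.elim_some, Nat.cast_ofNat]
    rw [add_assoc, add_comm (∑ e, _)]
  refine (le_iSup (fun r => F ⟨0, r⟩) r).trans ?_
  rw [ENNReal.le_div_iff_mul_le (Or.inl hpos) (Or.inl passProb_ne_top)]
  have hq : pass A β Θ W none * M ≠ ⊤ :=
    ENNReal.mul_ne_top (PMF.apply_ne_top _ _) hM
  refine (ENNReal.add_le_add_iff_right hq).1 ?_
  calc M * passProb A β Θ W + pass A β Θ W none * M
      = (pass A β Θ W none + passProb A β Θ W) * M := by ring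
    _ = M := by rw [pass_none_add, one_mul]
    _ ≤ _ := key

theorem halted_end (r : ℕ → ℝ) : program.Halted ⟨29, r⟩ := by
  simp [Program.Halted, program]

theorem expectedTime_le (hpos : passProb A β Θ W ≠ 0) :
    program.expectedTime A (data β Θ W) ≤ 21 / passProb A β Θ W := by
  rw [Program.expectedTime_eq_iSup]
  refine iSup_le fun t => ?_
  have := subharmonic_le (ψ := fun _ => 0) hpos
    (fun c _ => Program.timeUpTo_le_next program A (data β Θ W) t c)
    (ENNReal.natCast_ne_top t) (Program.timeUpTo_le _ _ _ t)
    (fun r e _ _ => (Program.timeUpTo_halted _ _ _ _ (halted_end r)).le) (fun _ => 0)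
  simpa [Config.init] using this

/-- The configurations that return the edge `e`. -/
def Returns (e : G.Dart) : Set Config :=
  {c | c.reg 0 = ((e.fst : ℕ) : ℝ) ∧ c.reg 1 = ((e.snd : ℕ) : ℝ)}

omit [NeZero n] [DecidableRel G.Adj] in
theorem returns_iff {e e' : G.Dart} {r : ℕ → ℝ} (h0 : r 0 = ((e'.fst : ℕ) : ℝ))
    (h1 : r 1 = ((e'.snd : ℕ) : ℝ)) {k : ℕ} : (⟨k, r⟩ : Config) ∈ Returns e ↔ e' = e := by
  simp only [Returns, Set.mem_ofPred_eq, h0, h1, Nat.cast_inj, Fin.val_inj]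
  exact ⟨fun h => SimpleGraph.Dart.ext _ _ (Prod.ext h.1 h.2), fun h => by simp [h]⟩

/-- The case `κ = 0`: the probability of having halted in `s` is at most that of `s` under the law
of a pass conditioned on success. -/
theorem iterate_indicator_le (hpos : passProb A β Θ W ≠ 0) (s : Set Config) (t : ℕ)
    {ψ : G.Dart → ℝ≥0∞}
    (h1 : ∀ r (e : G.Dart), r 0 = ((e.fst : ℕ) : ℝ) → r 1 = ((e.snd : ℕ) : ℝ) →
      (s.indicator 1 (⟨29, r⟩ : Config) : ℝ≥0∞) ≤ ψ e) :
    (program.next A (data β Θ W))^[t] ({c | program.Halted c ∧ c ∈ s}.indicator 1) Config.init ≤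
      (∑ e, pass A β Θ W (some e) * ψ e) / passProb A β Θ W := by
  have := subharmonic_le (κ := 0) (B := 1) (ψ := ψ) hpos
    (F := (program.next A (data β Θ W))^[t] ({c | program.Halted c ∧ c ∈ s}.indicator 1))
    (fun c _ => ?_) ENNReal.one_ne_top ?_ ?_ (fun _ => 0)
  · simpa [Config.init] using this
  · rw [zero_add]
    exact Program.iterate_next_le_succ _ _ _ (Program.indicator_halted_le_next _ _ _ s) t c
  · intro c
    induction t generalizing c with
    | zero => exact Set.indicator_le_self' (fun _ _ => zero_le) c
    | succ t ih =>
      rw [Function.iterate_succ_apply']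
      exact PMF.mean_le_of_le _ ih
  · intro r e hr0 hr1
    rw [Program.iterate_next_halted _ _ _ _ (halted_end r)]
    refine le_trans ?_ (h1 r e hr0 hr1)
    by_cases hs : (⟨29, r⟩ : Config) ∈ s
    · simp [hs, Set.indicator, halted_end r]
    · simp [hs]

/-- The upper bounds for `e` and for all other outputs add up to 1. Since the program halts almost
surely, neither can be strict in the limit. -/
theorem returnProb_eq (hpos : passProb A β Θ W ≠ 0) (e : G.Dart) :
    program.returnProb A (data β Θ W) e = pass A β Θ W (some e) / passProb A β Θ W := by
  classical
  set D := data β Θ W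
  have hR : program.returnProb A D e = ⨆ t, (program.next A D)^[t]
      ({c | program.Halted c ∧ c ∈ Returns e}.indicator 1) Config.init := by
    simp only [Program.returnProb, PMF.toOuterMeasure_eq_mean, Program.mean_run]
    rfl
  rw [hR]
  refine le_antisymm (iSup_le fun t => ?_) ?_
  · refine (iterate_indicator_le (ψ := fun e' => if e' = e then 1 else 0) hpos _ t ?_).trans ?_
    · intro r e' h0 h1
      by_cases h : e' = e <;> simp [Set.indicator, returns_iff h0 h1, h]
    · simp
  · set R := ⨆ t, (program.next A D)^[t]
      ({c | program.Halted c ∧ c ∈ Returns e}.indicator 1) Config.init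
    have hother : ∀ t, (program.next A D)^[t]
        ({c | program.Halted c ∧ c ∈ (Returns e)ᶜ}.indicator 1) Config.init ≤
        (∑ e' ∈ Finset.univ.erase e, pass A β Θ W (some e')) / passProb A β Θ W := by
      intro t
      refine (iterate_indicator_le (ψ := fun e' => if e' = e then 0 else 1) hpos _ t ?_).trans ?_
      · intro r e' h0 h1
        by_cases h : e' = e <;> simp [Set.indicator, returns_iff h0 h1, h]
      · rw [← Finset.add_sum_erase _ _ (Finset.mem_univ e)]
        simp only [if_true, mul_zero, zero_add]
        gcongr with e' he'
        simp [Finset.ne_of_mem_erase he']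
    set O := (∑ e' ∈ Finset.univ.erase e, pass A β Θ W (some e')) / passProb A β Θ W
    have hOe : O + pass A β Θ W (some e) / passProb A β Θ W = 1 := by
      rw [← ENNReal.add_div, Finset.sum_erase_add _ _ (Finset.mem_univ e), ← passProb,
        ENNReal.div_self hpos passProb_ne_top]
    have hO : O ≠ ⊤ := ne_top_of_le_ne_top ENNReal.one_ne_top (hOe ▸ le_self_add)
    -- The expected time is a convergent sum of the probabilities of still running, so these tend to
    -- zero.
    have hlim : Filter.Tendsto (fun t => (program.next A D)^[t]
        ({c | ¬ program.Halted c}.indicator 1) Config.init) Filter.atTop (nhds 0) := by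
      refine ENNReal.tendsto_atTop_zero_of_tsum_ne_top ?_
      refine ne_top_of_le_ne_top (ENNReal.div_ne_top (by simp) hpos)
        (le_trans (le_of_eq ?_) (expectedTime_le (A := A) (β := β) (Θ := Θ) (W := W) hpos))
      simp only [Program.expectedTime, PMF.toOuterMeasure_eq_mean, Program.mean_run]
      rfl
    have hsum : ∀ t, O + pass A β Θ W (some e) / passProb A β Θ W ≤
        O + (R + (program.next A D)^[t] ({c | ¬ program.Halted c}.indicator 1) Config.init) := by
      intro t
      rw [hOe]
      calc (1 : ℝ≥0∞) = (program.run A D t).mean fun _ => 1 := (PMF.mean_const _ _).symm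
        _ = (program.run A D t).mean fun c =>
              {c | program.Halted c ∧ c ∈ (Returns e)ᶜ}.indicator 1 c +
              ({c | program.Halted c ∧ c ∈ Returns e}.indicator 1 c +
                {c | ¬ program.Halted c}.indicator 1 c) := by
            congr 1
            ext c
            by_cases h : program.Halted c <;> by_cases h' : c ∈ Returns e <;>
              simp [Set.indicator, h, h']
        _ ≤ _ := by
            rw [PMF.mean_add, PMF.mean_add]
            simp only [Program.mean_run]
            gcongr
            · exact hother t
            · exact le_iSup (fun t => (program.next A D)^[t]
                ({c | program.Halted c ∧ c ∈ Returns e}.indicator 1) Config.init) t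
    have hlim' := (hlim.const_add R)
    rw [add_zero] at hlim'
    exact ge_of_tendsto' hlim' fun t => (ENNReal.add_le_add_iff_left hO).1 (hsum t)

end EdgeSampler

/-! ### The probability of each edge in one pass -/

namespace EdgeSampler

variable {n : ℕ} [NeZero n] {G : SimpleGraph (Fin n)} [DecidableRel G.Adj] {A : AdjList G}

omit [NeZero n] [DecidableRel G.Adj] in
theorem deg_pos_of_adj {v u : Fin n} (h : G.Adj v u) : 0 < A.deg v :=
  List.length_pos_of_mem ((A.mem_iff v u).2 h)

omit [NeZero n] [DecidableRel G.Adj] in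
theorem dart_eq_some_iff {v : Fin n} {i : ℕ} {e : G.Dart} :
    dart A v i = some e ↔ e.fst = v ∧ (A.list v)[i]? = some e.snd := by
  constructor
  · intro h
    refine ⟨dart_fst h, ?_⟩
    unfold dart at h
    split at h
    · rename_i hi
      cases h
      exact List.getElem?_eq_getElem hi
    · cases h
  · rintro ⟨rfl, h⟩
    obtain ⟨hi, h⟩ := List.getElem?_eq_some_iff.1 h
    have hi' : i < A.deg e.fst := hi
    rw [dart, dif_pos hi']
    congr 1
    exact SimpleGraph.Dart.ext _ _ (Prod.ext rfl h)

omit [NeZero n] [DecidableRel G.Adj] in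
theorem pick_mean (v : Fin n) (φ : Option G.Dart → ℝ≥0∞) :
    (pick A v).mean φ = ((A.deg v - 1 + 1 : ℕ) : ℝ≥0∞)⁻¹ *
      ∑ i ∈ Finset.range (A.deg v - 1 + 1), φ (dart A v i) := by
  rw [pick, PMF.mean_map, PMF.mean_uniform, Fintype.card_fin, Finset.sum_range]

-- An adjacency list has no repetitions, so exactly one index yields `e`.
omit [NeZero n] [DecidableRel G.Adj] in
theorem pick_some (v : Fin n) (e : G.Dart) :
    pick A v (some e) = if e.fst = v then (A.deg v : ℝ≥0∞)⁻¹ else 0 := by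
  rw [← PMF.mean_single, pick_mean]
  simp only [dart_eq_some_iff]
  split_ifs with h
  · subst h
    have hd := deg_pos_of_adj (A := A) e.adj
    rw [Nat.sub_add_cancel hd]
    obtain ⟨i, hi, hie⟩ := List.getElem_of_mem ((A.mem_iff _ _).2 e.adj)
    rw [Finset.sum_eq_single i]
    · simp [hi, hie]
    · intro j hj hji
      rw [if_neg]
      rintro ⟨-, h⟩
      obtain ⟨hj', h⟩ := List.getElem?_eq_some_iff.1 h
      exact hji ((A.nodup e.fst).getElem_inj_iff.1 (h.trans hie.symm))
    · intro h
      exact absurd (Finset.mem_range.2 hi) h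
  · simp [h]

omit [NeZero n] [DecidableRel G.Adj] in
theorem andThen_some [Fintype G.Dart] (p : PMF (Option G.Dart)) (f : G.Dart → PMF (Option G.Dart))
    (e : G.Dart) : andThen p f (some e) = ∑ e', p (some e') * f e' (some e) := by
  rw [andThen, PMF.bind_apply, tsum_fintype, Fintype.sum_option]
  simp

theorem flip_true {p : ℝ} (h1 : p ≤ 1) : Instr.flip p true = ENNReal.ofReal p := by
  have : p.toNNReal ≤ 1 := by simpa using h1
  simp [Instr.flip, ENNReal.ofReal, this]

theorem flip_false {p : ℝ} (h0 : 0 ≤ p) : Instr.flip p false = ENNReal.ofReal (1 - p) := by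
  have h : Instr.flip p true + Instr.flip p false = 1 := by
    have := (Instr.flip p).tsum_coe
    rwa [tsum_fintype, Fintype.sum_bool] at this
  by_cases h1 : p ≤ 1
  · rw [flip_true h1] at h
    rw [ENNReal.ofReal_sub _ h0, ENNReal.ofReal_one, ← h, ENNReal.add_sub_cancel_left (by simp)]
  · have h2 : (1 : NNReal) ≤ p.toNNReal := by simpa using (not_le.1 h1).le
    rw [ENNReal.ofReal_of_nonpos (by linarith)]
    simp [Instr.flip, h2]

-- The degree cancels: `(1/n) · (d/Θ) · (1/d)`.
omit [DecidableRel G.Adj] in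
theorem lightBranch_some {Θ : ℝ} (hΘ : 0 < Θ) (e : G.Dart) :
    lightBranch A Θ (some e) =
      if Θ < A.deg e.fst then 0 else ENNReal.ofReal (1 / (n * Θ)) := by
  classical
  have hd : (0 : ℝ) < A.deg e.fst := by exact_mod_cast deg_pos_of_adj (A := A) e.adj
  have hn : (0 : ℝ) < n := by exact_mod_cast Nat.pos_of_neZero n
  rw [lightBranch, PMF.bind_apply, tsum_fintype, Finset.sum_eq_single e.fst]
  · split_ifs with h
    · simp
    · rw [PMF.bind_apply, tsum_fintype, Fintype.sum_bool, flip_true]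
      · simp only [PMF.uniformOfFintype_apply, Fintype.card_fin, if_true, pick_some,
          Bool.false_eq_true, if_false, PMF.pure_apply, reduceCtorEq, mul_zero, add_zero]
        rw [← ENNReal.ofReal_natCast n, ← ENNReal.ofReal_natCast (A.deg e.fst),
          ← ENNReal.ofReal_inv_of_pos hn, ← ENNReal.ofReal_inv_of_pos hd,
          ← ENNReal.ofReal_mul (by positivity), ← ENNReal.ofReal_mul (by positivity)]
        congr 1
        field_simp
      · exact (div_le_one hΘ).2 (not_lt.1 h)
  · intro v _ hv
    have : (if Θ < A.deg v then PMF.pure none else (Instr.flip (A.deg v / Θ)).bind fun b =>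
        if b then pick A v else PMF.pure none) (some e) = 0 := by
      split_ifs with h
      · simp
      · rw [PMF.bind_apply, tsum_fintype, Fintype.sum_bool]
        simp [pick_some, Ne.symm hv]
    rw [this, mul_zero]
  · simp

/-- To return `e`, the first walk must end at the tail of `e`; from `v` exactly one edge does this,
provided that `v` is adjacent to that tail. -/
theorem heavyBranch_some {Θ : ℝ} {W : List (Fin n)} (hW : W ≠ []) (e : G.Dart) :
    heavyBranch A Θ W (some e) =
      if Θ < A.deg e.fst then (W.length : ℝ≥0∞)⁻¹ * ((W.map fun v =>
        if G.Adj v e.fst then (A.deg v : ℝ≥0∞)⁻¹ else 0).sum * (A.deg e.fst : ℝ≥0∞)⁻¹)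
      else 0 := by
  classical
  have hstep : ∀ v, andThen (pick A v) (fun e' =>
      if Θ < A.deg e'.snd then pick A e'.snd else PMF.pure none) (some e) =
      (if G.Adj v e.fst then (A.deg v : ℝ≥0∞)⁻¹ else 0) *
        (if Θ < A.deg e.fst then (A.deg e.fst : ℝ≥0∞)⁻¹ else 0) := by
    intro v
    rw [andThen_some]
    have hif : ∀ e' : G.Dart, (if Θ < A.deg e'.snd then pick A e'.snd else PMF.pure none)
        (some e) = if e.fst = e'.snd then
          (if Θ < A.deg e.fst then (A.deg e.fst : ℝ≥0∞)⁻¹ else 0) else 0 := by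
      intro e'
      by_cases h : e.fst = e'.snd
      · simp only [h, if_true]
        split_ifs <;> simp [pick_some, h]
      · split_ifs <;> simp [pick_some, h]
    simp only [hif, pick_some]
    by_cases hv : G.Adj v e.fst
    · rw [Finset.sum_eq_single ⟨(v, e.fst), hv⟩]
      · simp [hv]
      · intro e' _ he'
        by_cases h1 : e'.fst = v
        · by_cases h2 : e.fst = e'.snd
          · exact absurd (SimpleGraph.Dart.ext _ _ (Prod.ext h1 h2.symm)) he'
          · simp [h2]
        · simp [h1]
      · simp
    · rw [if_neg hv, zero_mul]
      refine Finset.sum_eq_zero fun e' _ => ?_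
      by_cases h1 : e'.fst = v
      · by_cases h2 : e.fst = e'.snd
        · exact absurd (h1 ▸ h2 ▸ e'.adj) hv
        · simp [h2]
      · simp [h1]
  rw [heavyBranch, ← PMF.mean_single, PMF.mean_bind]
  simp only [PMF.mean_single, hstep]
  rw [PMF.mean_uniform, ← Finset.sum_mul, Fintype.card_fin,
    ← Finset.sum_range (f := fun i => if G.Adj (W.getD i 0) e.fst then
      (A.deg (W.getD i 0) : ℝ≥0∞)⁻¹ else 0), Nat.sub_add_cancel (List.length_pos_iff.2 hW)]
  have hsum : ∑ i ∈ Finset.range W.length, (if G.Adj (W.getD i 0) e.fst then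
      (A.deg (W.getD i 0) : ℝ≥0∞)⁻¹ else 0) =
      (W.map fun v => if G.Adj v e.fst then (A.deg v : ℝ≥0∞)⁻¹ else 0).sum := by
    rw [Finset.sum_range, ← List.sum_ofFn]
    congr 1
    refine List.ext_getElem (by simp) fun i h1 h2 => ?_
    simp [List.getD_eq_getElem?_getD]
  rw [hsum]
  split_ifs <;> simp

variable (A) in
/-- The list in which every vertex is repeated as often as its degree says. -/
def repeatByDegree (S : List (Fin n)) : List (Fin n) :=
  S.flatMap fun v => List.replicate (A.deg v) v

variable (A) in
/-- The sum of the degrees of the vertices in a list. -/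
def degSum (S : List (Fin n)) : ℕ := (S.map A.deg).sum

variable (G) in
/-- The number of vertices in a list that are adjacent to a given vertex. -/
def adjCount (S : List (Fin n)) (u : Fin n) : ℕ := (S.map fun v => if G.Adj v u then 1 else 0).sum

omit [NeZero n] [DecidableRel G.Adj] in
theorem length_repeatByDegree (S : List (Fin n)) :
    (repeatByDegree A S).length = degSum A S := by
  simp [repeatByDegree, degSum, List.length_flatMap]

-- The `d(v)` copies of `v` cancel the probability `1/d(v)` of each edge out of `v`, so every
-- sampled neighbor of `u` counts once.
omit [NeZero n] in
theorem sum_repeatByDegree (S : List (Fin n)) (u : Fin n) :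
    ((repeatByDegree A S).map fun v => if G.Adj v u then (A.deg v : ℝ≥0∞)⁻¹ else 0).sum =
      adjCount G S u := by
  induction S with
  | nil => simp [repeatByDegree, adjCount]
  | cons v S ih =>
    have h1 : repeatByDegree A (v :: S) = List.replicate (A.deg v) v ++ repeatByDegree A S := by
      simp [repeatByDegree]
    have h2 : adjCount G (v :: S) u = (if G.Adj v u then 1 else 0) + adjCount G S u := by
      simp [adjCount]
    rw [h1, List.map_append, List.sum_append, ih, h2]
    push_cast
    congr 1
    rw [List.map_replicate, List.sum_replicate, nsmul_eq_mul]
    by_cases h : G.Adj v u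
    · have hd : A.deg v ≠ 0 := (deg_pos_of_adj (A := A) h).ne'
      simp only [h, if_true]
      exact ENNReal.mul_inv_cancel (by exact_mod_cast hd) (ENNReal.natCast_ne_top _)
    · simp [h]

theorem pass_some {β Θ : ℝ} (hβ0 : 0 ≤ β) (hβ1 : β ≤ 1) (hΘ : 0 < Θ) {S : List (Fin n)}
    (hS : β ≠ 0 → degSum A S ≠ 0) (e : G.Dart) :
    pass A β Θ (repeatByDegree A S) (some e) = ENNReal.ofReal
      (if Θ < A.deg e.fst then β * (adjCount G S e.fst / (degSum A S * A.deg e.fst))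
        else (1 - β) / (n * Θ)) := by
  have hd : (0 : ℝ) < A.deg e.fst := by exact_mod_cast deg_pos_of_adj (A := A) e.adj
  rw [pass, PMF.bind_apply, tsum_fintype, Fintype.sum_bool, flip_true hβ1, flip_false hβ0]
  simp only [if_true, Bool.false_eq_true, if_false, lightBranch_some hΘ]
  have hlight : ENNReal.ofReal (1 - β) * ENNReal.ofReal (1 / (n * Θ)) =
      ENNReal.ofReal ((1 - β) / (n * Θ)) := by
    rw [← ENNReal.ofReal_mul (by linarith), mul_one_div]
  rcases eq_or_ne β 0 with rfl | hβ
  -- For `β = 0` the stored list may be empty; the heavy branch then has weight zero.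
  · split_ifs
    · simp
    · rw [hlight]; simp
  · have hN := hS hβ
    have hW : repeatByDegree A S ≠ [] := by
      rw [← List.length_pos_iff, length_repeatByDegree]
      exact Nat.pos_of_ne_zero hN
    have hN' : (0 : ℝ) < degSum A S := by exact_mod_cast Nat.pos_of_ne_zero hN
    rw [heavyBranch_some hW, length_repeatByDegree, sum_repeatByDegree]
    split_ifs
    · rw [mul_zero, add_zero, ← ENNReal.ofReal_natCast (degSum A S),
        ← ENNReal.ofReal_natCast (A.deg e.fst), ← ENNReal.ofReal_natCast (adjCount G S _),
        ← ENNReal.ofReal_inv_of_pos hN', ← ENNReal.ofReal_inv_of_pos hd,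
        ← ENNReal.ofReal_mul (by positivity), ← ENNReal.ofReal_mul (by positivity),
        ← ENNReal.ofReal_mul hβ0]
      congr 1
      field_simp
    · rw [hlight]; simp

end EdgeSampler

/-! ### Balanced branches and good samples -/

namespace EdgeSampler

variable {n : ℕ} [NeZero n] {G : SimpleGraph (Fin n)} [DecidableRel G.Adj] {A : AdjList G}

omit [NeZero n] in
theorem adjCount_le_degSum (S : List (Fin n)) (u : Fin n) : adjCount G S u ≤ degSum A S := by
  refine List.sum_le_sum fun v _ => ?_
  split_ifs with h
  · exact deg_pos_of_adj h
  · exact Nat.zero_le _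

variable (A) in
/-- The probability of the second branch that balances the two branches. -/
def branchProb (Θ : ℝ) (S : List (Fin n)) : ℝ := degSum A S / (Θ * S.length + degSum A S)

variable (A) in
/-- The data array that is made from a sample `S` of vertices. -/
def sampleData (Θ : ℝ) (S : List (Fin n)) : List ℝ :=
  data (branchProb A Θ S) Θ (repeatByDegree A S)

variable (A) in
/-- A sample of vertices that makes the sampling procedure work. -/
structure IsGoodSample (η Θ : ℝ) (S : List (Fin n)) : Prop where
  ne_nil : S ≠ []
  degSum_le : (degSum A S : ℝ) ≤ 2 * Θ * S.length
  adjCount_close : ∀ u, Θ < A.deg u →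
    |(adjCount G S u : ℝ) - S.length * A.deg u / n| ≤ η * (S.length * A.deg u / n)

/-- With `β = N/(Θs+N)`, light edges get exactly `s/(n(Θs+N))`. Heavy ones get this value times
`c(u) n / (s d(u))`, the relative error of the count `c(u)`. -/
theorem pass_bounds {η Θ : ℝ} (hΘ : 0 < Θ) (hη0 : 0 ≤ η) (hη : η < 1) {S : List (Fin n)}
    (hS : IsGoodSample A η Θ S) (e : G.Dart) :
    ∃ a : ℝ, pass A (branchProb A Θ S) Θ (repeatByDegree A S) (some e) = ENNReal.ofReal a ∧
      (1 - η) * (S.length / (n * (Θ * S.length + degSum A S))) ≤ a ∧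
      a ≤ (1 + η) * (S.length / (n * (Θ * S.length + degSum A S))) := by
  have hs : (0 : ℝ) < S.length := by exact_mod_cast List.length_pos_iff.2 hS.ne_nil
  have hn : (0 : ℝ) < n := by exact_mod_cast Nat.pos_of_neZero n
  have hN : (0 : ℝ) ≤ degSum A S := Nat.cast_nonneg _
  have hden : 0 < Θ * S.length + degSum A S := by positivity
  have hβ0 : 0 ≤ branchProb A Θ S := by unfold branchProb; positivity
  have hβ1 : branchProb A Θ S ≤ 1 := (div_le_one hden).2 (by nlinarith)
  have hβ : branchProb A Θ S ≠ 0 → degSum A S ≠ 0 := fun h h' => h (by simp [branchProb, h'])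
  refine ⟨_, pass_some hβ0 hβ1 hΘ hβ e, ?_⟩
  set s : ℝ := (S.length : ℝ)
  set N : ℝ := (degSum A S : ℝ)
  have hβdef : branchProb A Θ S = N / (Θ * s + N) := rfl
  split_ifs with h
  · have hd : (0 : ℝ) < A.deg e.fst := hΘ.trans h
    have hc := abs_le.1 (hS.adjCount_close e.fst h)
    have hcN : (adjCount G S e.fst : ℝ) ≤ N := Nat.cast_le.2 (adjCount_le_degSum S e.fst)
    have hpos : 0 < (1 - η) * (s * A.deg e.fst / n) := mul_pos (by linarith) (by positivity)
    -- The count of sampled neighbors is positive, being close to its mean, and it is at most `N`.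
    have hNpos : 0 < N := by nlinarith
    have heq : branchProb A Θ S * (adjCount G S e.fst / (N * A.deg e.fst)) =
        adjCount G S e.fst * (n / (s * A.deg e.fst)) * (s / (n * (Θ * s + N))) := by
      rw [hβdef]
      field_simp
    have hcancel : s * A.deg e.fst / n * (n / (s * A.deg e.fst)) = 1 := by field_simp
    have hq : 0 < n / (s * A.deg e.fst) := by positivity
    rw [heq]
    constructor
    · refine mul_le_mul_of_nonneg_right ?_ (by positivity)
      have := mul_le_mul_of_nonneg_right (show (1 - η) * (s * A.deg e.fst / n) ≤
        adjCount G S e.fst by linarith) hq.le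
      rwa [mul_assoc, hcancel, mul_one] at this
    · refine mul_le_mul_of_nonneg_right ?_ (by positivity)
      have := mul_le_mul_of_nonneg_right (show (adjCount G S e.fst : ℝ) ≤
        (1 + η) * (s * A.deg e.fst / n) by linarith) hq.le
      rwa [mul_assoc (1 + η), hcancel, mul_one] at this
  · have heq : (1 - branchProb A Θ S) / (n * Θ) = s / (n * (Θ * s + N)) := by
      rw [hβdef]
      field_simp
      ring
    have hτ : 0 < s / (n * (Θ * s + N)) := by positivity
    rw [heq]
    constructor <;> nlinarith

/-- Conditioning on success divides two quantities with relative error `ε/2`, which costs a factor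
between `(1-ε/2)/(1+ε/2)` and its inverse; both are within `2ε` of 1. -/
theorem sampling_correct [Nonempty G.Dart] {ε Θ : ℝ} (hε : 0 < ε) (hε2 : ε < 1 / 2) (hΘ : 0 < Θ)
    {S : List (Fin n)} (hS : IsGoodSample A (ε / 2) Θ S) :
    (∃ P : PMF G.Dart, (∀ e, program.returnProb A (sampleData A Θ S) e = P e) ∧
      PointwiseClose P (PMF.uniformOfFintype G.Dart) (2 * ε)) ∧
    program.expectedTime A (sampleData A Θ S) ≤ ENNReal.ofReal (84 * Θ / avgDeg G) := by
  choose a ha hal hau using pass_bounds (A := A) hΘ (by linarith) (by linarith : ε / 2 < 1) hS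
  have hs : (0 : ℝ) < S.length := by exact_mod_cast List.length_pos_iff.2 hS.ne_nil
  have hn : (0 : ℝ) < n := by exact_mod_cast Nat.pos_of_neZero n
  have hm : (0 : ℝ) < Fintype.card G.Dart := by exact_mod_cast Fintype.card_pos
  set m : ℝ := (Fintype.card G.Dart : ℝ) with hmdef
  set τ : ℝ := S.length / (n * (Θ * S.length + degSum A S)) with hτdef
  have hden : 0 < Θ * S.length + degSum A S := by positivity
  have hτ : 0 < τ := by positivity
  have hapos : ∀ e, 0 < a e := fun e => lt_of_lt_of_le (mul_pos (by linarith) hτ) (hal e)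
  set T := ∑ e, a e with hT
  have hTl : (1 - ε / 2) * (m * τ) ≤ T := by
    calc _ = ∑ _e : G.Dart, (1 - ε / 2) * τ := by
          rw [Finset.sum_const, Finset.card_univ, nsmul_eq_mul]; ring
      _ ≤ T := Finset.sum_le_sum fun e _ => hal e
  have hTu : T ≤ (1 + ε / 2) * (m * τ) := by
    calc T ≤ ∑ _e : G.Dart, (1 + ε / 2) * τ := Finset.sum_le_sum fun e _ => hau e
      _ = _ := by rw [Finset.sum_const, Finset.card_univ, nsmul_eq_mul]; ring
  have hTpos : 0 < T := lt_of_lt_of_le (mul_pos (by linarith) (by positivity)) hTl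
  have hpass : passProb A (branchProb A Θ S) Θ (repeatByDegree A S) = ENNReal.ofReal T := by
    rw [passProb, hT, ENNReal.ofReal_sum_of_nonneg fun e _ => (hapos e).le]
    exact Finset.sum_congr rfl fun e _ => ha e
  have hne : passProb A (branchProb A Θ S) Θ (repeatByDegree A S) ≠ 0 := by
    rw [hpass]; simpa using hTpos
  have hret : ∀ e, program.returnProb A (sampleData A Θ S) e = ENNReal.ofReal (a e / T) := by
    intro e
    rw [sampleData, returnProb_eq hne, hpass, ha, ENNReal.ofReal_div_of_pos hTpos]
  constructor
  · refine ⟨PMF.ofFintype (fun e => ENNReal.ofReal (a e / T)) ?_, hret, ?_⟩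
    · rw [← ENNReal.ofReal_sum_of_nonneg fun e _ => (div_pos (hapos e) hTpos).le,
        ← Finset.sum_div, ← hT, div_self hTpos.ne', ENNReal.ofReal_one]
    · intro e
      rw [PMF.ofFintype_apply, ENNReal.toReal_ofReal (div_pos (hapos e) hTpos).le,
        PMF.uniformOfFintype_apply, ENNReal.toReal_inv, ENNReal.toReal_natCast, ← hmdef, abs_le]
      have hq : a e / T - m⁻¹ = (a e * m - T) / (T * m) := by
        field_simp
      have hr : 2 * ε * m⁻¹ = 2 * ε * T / (T * m) := by field_simp
      have h1 := mul_le_mul_of_nonneg_right (hal e) hm.le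
      have h2 := mul_le_mul_of_nonneg_right (hau e) hm.le
      have hmτ : 0 < m * τ := by positivity
      rw [hq, hr, ← neg_div]
      constructor
      · refine div_le_div_of_nonneg_right ?_ (by positivity)
        nlinarith
      · refine div_le_div_of_nonneg_right ?_ (by positivity)
        nlinarith
  · rw [sampleData]
    refine (expectedTime_le hne).trans ?_
    rw [hpass, show (21 : ℝ≥0∞) = ENNReal.ofReal 21 by simp,
      ← ENNReal.ofReal_div_of_pos hTpos]
    refine ENNReal.ofReal_le_ofReal ?_
    have hd : (degSum A S : ℝ) ≤ 2 * Θ * S.length := hS.degSum_le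
    -- From `N ≤ 2Θs`. Together with `1 - ε/2 ≥ 3/4` the success probability is at least `m/(4nΘ)`,
    -- and `84 = 21 · 4`.
    have hτl : 1 / (n * (3 * Θ)) ≤ τ := by
      rw [hτdef, div_le_div_iff₀ (by positivity) (by positivity)]
      nlinarith
    have hTl' : m / (4 * n * Θ) ≤ T := by
      calc m / (4 * n * Θ) = (3 / 4) * (m * (1 / (n * (3 * Θ)))) := by field_simp
        _ ≤ (1 - ε / 2) * (m * τ) := 
              mul_le_mul (by linarith) (by gcongr) (by positivity) (by linarith)
        _ ≤ T := hTl
    calc 21 / T ≤ 21 / (m / (4 * n * Θ)) := by gcongr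
      _ = 84 * Θ / avgDeg G := by
        rw [avgDeg, ← hmdef]
        field_simp
        norm_num

end EdgeSampler

/-! ### Composition of query algorithms and concentration -/

namespace QueryAlg

variable {n : ℕ} {α β : Type}

/-- Run one algorithm after another. -/
def bind : QueryAlg n α → (α → QueryAlg n β) → QueryAlg n β
  | ret a, f => f a
  | rand k next, f => rand k fun i => (next i).bind f
  | vertex next, f => vertex fun v => (next v).bind f
  | degree v next, f => degree v fun d => (next d).bind f
  | neighbor v i next, f => neighbor v i fun u => (next u).bind f

/-- Run an algorithm repeatedly and list the results. -/
def replicate (a : QueryAlg n α) : ℕ → QueryAlg n (List α)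
  | 0 => ret []
  | q + 1 => a.bind fun x => (replicate a q).bind fun l => ret (x :: l)

variable [NeZero n] {G : SimpleGraph (Fin n)} (A : AdjList G)

theorem output_bind (a : QueryAlg n α) (f : α → QueryAlg n β) :
    (a.bind f).output A = (a.output A).bind fun x => (f x).output A := by
  induction a with
  | ret a => simp [bind, output]
  | rand k next ih => simp [bind, output, ih]
  | vertex next ih => simp [bind, output, ih]
  | degree v next ih => simp [bind, output, ih]
  | neighbor v i next ih => simp [bind, output, ih]

theorem mean_output_bind (a : QueryAlg n α) (f : α → QueryAlg n β) (g : β → ℝ≥0∞) :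
    ((a.bind f).output A).mean g = (a.output A).mean fun x => ((f x).output A).mean g := by
  rw [output_bind, PMF.mean_bind]

theorem expectedQueries_bind (a : QueryAlg n α) (f : α → QueryAlg n β) :
    (a.bind f).expectedQueries A =
      a.expectedQueries A + (a.output A).mean fun x => (f x).expectedQueries A := by
  induction a with
  | ret a => simp [bind, output, expectedQueries, PMF.mean_pure]
  | rand k next ih =>
    simp only [bind, output, expectedQueries, ih, PMF.mean_bind]
    exact PMF.mean_add _ _ _
  | vertex next ih =>
    simp only [bind, output, expectedQueries, ih, PMF.mean_bind, add_assoc]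
    congr 1
    exact PMF.mean_add _ _ _
  | degree v next ih => simp only [bind, output, expectedQueries, ih, add_assoc]
  | neighbor v i next ih => simp only [bind, output, expectedQueries, ih, add_assoc]

theorem expectedQueries_replicate (a : QueryAlg n α) (q : ℕ) :
    (a.replicate q).expectedQueries A = q * a.expectedQueries A := by
  induction q with
  | zero => simp [replicate, expectedQueries]
  | succ q ih =>
    simp only [replicate, expectedQueries_bind, ih, expectedQueries, PMF.mean_const, add_zero]
    push_cast
    ring

/-- Independence of the repetitions, in the form needed for exponential moments and for events about
all repetitions. -/
theorem mean_prod_replicate (a : QueryAlg n α) (q : ℕ) (f : α → ℝ≥0∞) :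
    ((a.replicate q).output A).mean (fun l => (l.map f).prod) = ((a.output A).mean f) ^ q := by
  induction q with
  | zero => simp [replicate, output, PMF.mean_pure]
  | succ q ih =>
    simp only [replicate, mean_output_bind, output, PMF.mean_pure, List.map_cons, List.prod_cons,
      PMF.mean_const_mul, PMF.mean_mul_const, ih, pow_succ']

theorem mean_sum_replicate (a : QueryAlg n α) (q : ℕ) (f : α → ℝ≥0∞) :
    ((a.replicate q).output A).mean (fun l => (l.map f).sum) = q * (a.output A).mean f := by
  induction q with
  | zero => simp [replicate, output, PMF.mean_pure]
  | succ q ih =>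
    simp only [replicate, mean_output_bind, output, PMF.mean_pure, List.map_cons, List.sum_cons,
      PMF.mean_add, PMF.mean_const, ih]
    push_cast
    ring

/-- The probability that the result has a given property. -/
def prob (a : QueryAlg n α) (P : α → Prop) : ℝ≥0∞ := (a.output A).toOuterMeasure {x | P x}

open Classical in
theorem prob_eq_mean (a : QueryAlg n α) (P : α → Prop) :
    a.prob A P = (a.output A).mean fun x => if P x then 1 else 0 := by
  rw [prob, PMF.toOuterMeasure_eq_mean]
  rfl

theorem prob_mono (a : QueryAlg n α) {P Q : α → Prop} (h : ∀ x, P x → Q x) :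
    a.prob A P ≤ a.prob A Q :=
  (a.output A).toOuterMeasure.mono h

theorem prob_or_le (a : QueryAlg n α) (P Q : α → Prop) :
    a.prob A (fun x => P x ∨ Q x) ≤ a.prob A P + a.prob A Q :=
  MeasureTheory.measure_union_le _ _

theorem prob_exists_le {ι : Type*} (a : QueryAlg n α) (s : Finset ι) (P : ι → α → Prop) :
    a.prob A (fun x => ∃ i ∈ s, P i x) ≤ ∑ i ∈ s, a.prob A (P i) := by
  have : {x | ∃ i ∈ s, P i x} = ⋃ i ∈ s, {x | P i x} := by ext; simp
  rw [prob, this]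
  exact MeasureTheory.measure_biUnion_finset_le _ _

theorem prob_le_one (a : QueryAlg n α) (P : α → Prop) : a.prob A P ≤ 1 := by
  classical
  rw [prob_eq_mean]
  exact PMF.mean_le_of_le _ fun x => by split_ifs <;> simp

theorem prob_add_not (a : QueryAlg n α) (P : α → Prop) :
    a.prob A P + a.prob A (fun x => ¬ P x) = 1 := by
  classical
  rw [prob_eq_mean, prob_eq_mean, ← PMF.mean_add]
  refine Eq.trans ?_ (PMF.mean_const (a.output A) 1)
  congr 1
  ext x
  by_cases h : P x <;> simp [h]

theorem markov (a : QueryAlg n α) (P : α → Prop) (f : α → ℝ≥0∞) {c : ℝ≥0∞}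
    (h : ∀ x, P x → c ≤ f x) : c * a.prob A P ≤ (a.output A).mean f := by
  classical
  rw [prob_eq_mean, ← PMF.mean_const_mul]
  refine PMF.mean_mono _ fun x => ?_
  split_ifs with hx
  · simpa using h x hx
  · simp

theorem prob_length_replicate (a : QueryAlg n α) (q : ℕ) :
    (a.replicate q).prob A (fun l => l.length ≠ q) = 0 := by
  classical
  induction q with
  | zero => simp [prob_eq_mean, replicate, output, PMF.mean_pure]
  | succ q ih =>
    rw [prob_eq_mean] at ih ⊢
    simp only [replicate, mean_output_bind, output, PMF.mean_pure, List.length_cons,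
      ne_eq, add_left_inj] at ih ⊢
    simp only [PMF.mean_const]
    convert ih

theorem prob_exists_replicate_le (a : QueryAlg n α) (q : ℕ) (P : α → Prop) :
    (a.replicate q).prob A (fun l => ∃ x ∈ l, P x) ≤ q * a.prob A P := by
  classical
  rw [prob_eq_mean, prob_eq_mean, ← mean_sum_replicate]
  refine PMF.mean_mono _ fun l => ?_
  split_ifs with h
  · obtain ⟨x, hx, hP⟩ := h
    have := List.single_le_sum (l := l.map fun x => if P x then (1 : ℝ≥0∞) else 0)
      (fun _ _ => zero_le) 1 (List.mem_map.2 ⟨x, hx, by simp [hP]⟩)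
    exact this
  · exact zero_le

theorem prob_forall_replicate (a : QueryAlg n α) (q : ℕ) (P : α → Prop) :
    (a.replicate q).prob A (fun l => ∀ x ∈ l, P x) = a.prob A P ^ q := by
  classical
  rw [prob_eq_mean, prob_eq_mean, ← mean_prod_replicate]
  congr 1
  ext l
  induction l with
  | nil => simp
  | cons x l ih =>
    rw [List.map_cons, List.prod_cons, ← ih]
    by_cases hx : P x <;> simp [hx]

/-- Conditioning on the result of the first part: it is good up to a small probability, and in
that case the second part rarely has the property. -/
theorem prob_bind_le (a : QueryAlg n α) (f : α → QueryAlg n β) (Good : α → Prop)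
    (P : β → Prop) {ρ : ℝ≥0∞} (h : ∀ x, Good x → (f x).prob A P ≤ ρ) :
    (a.bind f).prob A P ≤ a.prob A (fun x => ¬ Good x) + ρ := by
  classical
  rw [prob_eq_mean, mean_output_bind, prob_eq_mean, ← PMF.mean_const (a.output A) ρ,
    ← PMF.mean_add]
  refine PMF.mean_mono _ fun x => ?_
  simp only [← prob_eq_mean]
  by_cases hx : Good x
  · simpa [hx] using h x hx
  · simpa [hx] using le_add_right (prob_le_one A (f x) P)

/-- A bad first result is charged the worst-case cost `B`, weighted by its probability. -/
theorem expectedQueries_bind_le (a : QueryAlg n α) (f : α → QueryAlg n β) (Good : α → Prop)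
    {B c : ℝ≥0∞} (h : ∀ x, Good x → (f x).expectedQueries A ≤ c)
    (hB : ∀ x, (f x).expectedQueries A ≤ B) :
    (a.bind f).expectedQueries A ≤
      a.expectedQueries A + (B * a.prob A (fun x => ¬ Good x) + c) := by
  classical
  rw [expectedQueries_bind, prob_eq_mean, ← PMF.mean_const (a.output A) c, ← PMF.mean_const_mul,
    ← PMF.mean_add]
  gcongr
  refine PMF.mean_mono _ fun x => ?_
  by_cases hx : Good x
  · simpa [hx] using h x hx
  · simpa [hx] using le_add_right (hB x)

/-- The exponential moment of a bounded quantity. -/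
theorem mean_exp_le (a : QueryAlg n α) (f : α → ℝ) (hf0 : ∀ x, 0 ≤ f x) (hf1 : ∀ x, f x ≤ 1)
    {μ : ℝ} (hμ0 : 0 ≤ μ)
    (hμ : (a.output A).mean (fun x => ENNReal.ofReal (f x)) = ENNReal.ofReal μ) {t : ℝ}
    (ht : |t| ≤ 1) :
    (a.output A).mean (fun x => ENNReal.ofReal (Real.exp (t * f x))) ≤
      ENNReal.ofReal (Real.exp ((t + t ^ 2) * μ)) := by
  have hpt : ∀ x, Real.exp (t * f x) ≤ 1 + (t + t ^ 2) * f x := by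
    intro x
    have habs : |t * f x| ≤ 1 := by
      rw [abs_mul, abs_of_nonneg (hf0 x)]
      exact mul_le_one₀ ht (hf0 x) (hf1 x)
    have h1 := (abs_le.1 (Real.abs_exp_sub_one_sub_id_le habs)).2
    have h2 : (t * f x) ^ 2 ≤ t ^ 2 * f x := by
      rw [mul_pow]
      exact mul_le_mul_of_nonneg_left (by nlinarith [hf0 x, hf1 x]) (sq_nonneg t)
    linarith
  -- Keeps `1 + (t + t²) f` nonnegative, so that `ENNReal.ofReal` does not truncate it.
  have hc : -1 ≤ t + t ^ 2 := by nlinarith [sq_nonneg (t + 1), (abs_le.1 ht).1]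
  have key : (a.output A).mean (fun x => ENNReal.ofReal (1 + (t + t ^ 2) * f x)) ≤
      ENNReal.ofReal (1 + (t + t ^ 2) * μ) := by
    rcases le_total 0 (t + t ^ 2) with h | h
    · rw [ENNReal.ofReal_add zero_le_one (mul_nonneg h hμ0), ENNReal.ofReal_mul h, ← hμ,
        ← PMF.mean_const_mul, ← PMF.mean_const_add]
      refine PMF.mean_mono _ fun x => ?_
      rw [ENNReal.ofReal_add zero_le_one (mul_nonneg h (hf0 x)), ENNReal.ofReal_mul h,
        ENNReal.ofReal_one]
    -- A negative slope cannot be moved out of a mean in `ℝ≥0∞`, so the mean of the complementary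
    -- part is computed instead.
    · have hsum : (a.output A).mean (fun x => ENNReal.ofReal (1 + (t + t ^ 2) * f x)) +
          ENNReal.ofReal (-(t + t ^ 2)) * ENNReal.ofReal μ = 1 := by
        rw [← hμ, ← PMF.mean_const_mul, ← PMF.mean_add]
        refine Eq.trans ?_ (PMF.mean_const (a.output A) 1)
        congr 1
        ext x
        rw [← ENNReal.ofReal_mul (by linarith), ← ENNReal.ofReal_add]
        · rw [show 1 + (t + t ^ 2) * f x + -(t + t ^ 2) * f x = 1 by ring, ENNReal.ofReal_one]
        · nlinarith [hf0 x, hf1 x]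
        · exact mul_nonneg (by linarith) (hf0 x)
      rw [show 1 + (t + t ^ 2) * μ = 1 - -(t + t ^ 2) * μ by ring,
        ENNReal.ofReal_sub _ (mul_nonneg (by linarith) hμ0), ENNReal.ofReal_one, ← hsum,
        ENNReal.ofReal_mul (by linarith),
        ENNReal.add_sub_cancel_right (ENNReal.mul_ne_top (by simp) (by simp))]
  calc _ ≤ _ := PMF.mean_mono _ fun x => ENNReal.ofReal_le_ofReal (hpt x)
    _ ≤ _ := key
    _ ≤ _ := ENNReal.ofReal_le_ofReal (by
      have := Real.add_one_le_exp ((t + t ^ 2) * μ)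
      linarith)

theorem exp_mul_sum (t : ℝ) (f : α → ℝ) (l : List α) :
    ENNReal.ofReal (Real.exp (t * (l.map f).sum)) =
      (l.map fun x => ENNReal.ofReal (Real.exp (t * f x))).prod := by
  induction l with
  | nil => simp
  | cons x l ih =>
    simp only [List.map_cons, List.sum_cons, List.prod_cons]
    rw [← ih, mul_add, Real.exp_add, ENNReal.ofReal_mul (Real.exp_pos _).le]

/-- Markov's inequality for `exp (t · sum)`; the linear part of the exponent cancels. The sign of
`t` selects the tail. -/
theorem prob_exp_le (a : QueryAlg n α) (f : α → ℝ) (hf0 : ∀ x, 0 ≤ f x) (hf1 : ∀ x, f x ≤ 1)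
    {μ : ℝ} (hμ0 : 0 ≤ μ)
    (hμ : (a.output A).mean (fun x => ENNReal.ofReal (f x)) = ENNReal.ofReal μ) (q : ℕ) {t c : ℝ}
    (ht : |t| ≤ 1) :
    (a.replicate q).prob A (fun l => c ≤ t * ((l.map f).sum - q * μ)) ≤
      ENNReal.ofReal (Real.exp (t ^ 2 * (q * μ) - c)) := by
  have h1 := markov A (a.replicate q) (fun l => c ≤ t * ((l.map f).sum - q * μ))
    (fun l => ENNReal.ofReal (Real.exp (t * (l.map f).sum)))
    (c := ENNReal.ofReal (Real.exp (c + t * (q * μ))))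
    (fun l hl => ENNReal.ofReal_le_ofReal (Real.exp_le_exp.2 (by linarith)))
  simp only [exp_mul_sum] at h1
  rw [mean_prod_replicate] at h1
  have h2 := h1.trans (pow_le_pow_left₀ zero_le (mean_exp_le A a f hf0 hf1 hμ0 hμ ht) q)
  rw [← ENNReal.ofReal_pow (Real.exp_pos _).le, ← Real.exp_nat_mul] at h2
  have hpos := Real.exp_pos (c + t * (q * μ))
  rw [mul_comm, ← ENNReal.le_div_iff_mul_le (Or.inl (by simpa using hpos)) (Or.inl (by simp)),
    ← ENNReal.ofReal_div_of_pos hpos, ← Real.exp_sub] at h2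
  refine h2.trans (le_of_eq ?_)
  congr 2
  ring

/-- A two-sided Chernoff bound. -/
theorem chernoff (a : QueryAlg n α) (f : α → ℝ) (hf0 : ∀ x, 0 ≤ f x) (hf1 : ∀ x, f x ≤ 1)
    {μ M η : ℝ} (hμ0 : 0 ≤ μ)
    (hμ : (a.output A).mean (fun x => ENNReal.ofReal (f x)) = ENNReal.ofReal μ) (q : ℕ)
    (hM : q * μ ≤ M) (hη0 : 0 ≤ η) (hη : η ≤ 2) :
    (a.replicate q).prob A (fun l => ¬ |(l.map f).sum - q * μ| ≤ η * M) ≤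
      ENNReal.ofReal (2 * Real.exp (-(η ^ 2 * M / 4))) := by
  -- At `|t| = η/2` the exponent is at most `η²M/4 - η²M/2`; `η ≤ 2` ensures `|t| ≤ 1`.
  have hbound : ∀ t : ℝ, |t| = η / 2 →
      (a.replicate q).prob A (fun l => η ^ 2 * M / 2 ≤ t * ((l.map f).sum - q * μ)) ≤
        ENNReal.ofReal (Real.exp (-(η ^ 2 * M / 4))) := by
    intro t ht
    refine (prob_exp_le A a f hf0 hf1 hμ0 hμ q (by linarith)).trans ?_
    refine ENNReal.ofReal_le_ofReal (Real.exp_le_exp.2 ?_)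
    rw [← sq_abs, ht]
    nlinarith [mul_le_mul_of_nonneg_left hM (sq_nonneg η)]
  calc _ ≤ (a.replicate q).prob A (fun l =>
          η ^ 2 * M / 2 ≤ η / 2 * ((l.map f).sum - q * μ) ∨
          η ^ 2 * M / 2 ≤ -(η / 2) * ((l.map f).sum - q * μ)) := by
        refine prob_mono A _ fun l hl => ?_
        rcases lt_abs.1 (not_le.1 hl) with h | h
        · left; nlinarith
        · right; nlinarith
    _ ≤ _ := prob_or_le A _ _ _
    _ ≤ ENNReal.ofReal (Real.exp (-(η ^ 2 * M / 4))) +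
          ENNReal.ofReal (Real.exp (-(η ^ 2 * M / 4))) := by
        gcongr
        · exact hbound _ (abs_of_nonneg (by linarith))
        · exact hbound _ (by rw [abs_neg, abs_of_nonneg (by linarith)])
    _ = _ := by
        rw [← ENNReal.ofReal_add (Real.exp_pos _).le (Real.exp_pos _).le]
        congr 1
        ring

end QueryAlg

/-! ### A bounded estimator for the average degree -/

namespace EdgeSampler

variable {n : ℕ}

/-- The weight of an oriented edge with the given degrees of its endpoints. -/
def weight (T : ℝ) (d d' : ℕ) : ℝ := if T < d then 0 else if T < d' then 2 else 1

theorem weight_nonneg (T : ℝ) (d d' : ℕ) : 0 ≤ weight T d d' := by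
  unfold weight; split_ifs <;> norm_num

/-- Large degrees have weight zero. This boundedness is what makes the Chernoff bound applicable. -/
theorem mul_weight_le {T : ℝ} (hT : 0 ≤ T) (d d' : ℕ) : d * weight T d d' ≤ 2 * T := by
  unfold weight
  split_ifs with h1 h2 <;> linarith

/-- Draw a random edge out of a random vertex, and report the degrees of its endpoints (two zeros
if the vertex is isolated). -/
def edgeDegrees (n : ℕ) : QueryAlg n (ℕ × ℕ) :=
  .vertex fun v => .degree v fun d => .rand (d - 1) fun i => .neighbor v i fun o =>
    match o with
    | none => .ret (0, 0)
    | some u => .degree u fun d' => .ret (d, d')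

/-- An estimator for the average degree. -/
def degreeSample (T : ℝ) (x : ℕ × ℕ) : ℝ := x.1 * weight T x.1 x.2

variable [NeZero n] {G : SimpleGraph (Fin n)} (A : AdjList G)

omit [NeZero n] in
theorem nbr_eq (v : Fin n) (i : ℕ) : A.nbr v i = (dart A v i).map fun e => e.snd := by
  unfold dart AdjList.nbr
  split_ifs with h
  · exact List.getElem?_eq_getElem h
  · exact List.getElem?_eq_none (not_lt.1 h)

theorem mean_edgeDegrees (g : ℕ × ℕ → ℝ≥0∞) :
    ((edgeDegrees n).output A).mean g =
      (PMF.uniformOfFintype (Fin n)).mean fun v => (pick A v).mean fun o =>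
        o.elim (g (0, 0)) fun e => g (A.deg e.fst, A.deg e.snd) := by
  simp only [edgeDegrees, QueryAlg.output, PMF.mean_bind, pick, PMF.mean_map]
  congr 1
  ext v
  congr 1
  ext i
  rw [nbr_eq]
  cases h : dart A v i with
  | none => simp [QueryAlg.output, PMF.mean_pure]
  | some e => simp [QueryAlg.output, PMF.mean_pure, dart_fst h]

theorem expectedQueries_edgeDegrees : (edgeDegrees n).expectedQueries A ≤ 4 := by
  simp only [edgeDegrees, QueryAlg.expectedQueries]
  calc _ ≤ (1 : ℝ≥0∞) + (1 + 2) := by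
        gcongr
        refine PMF.mean_le_of_le _ fun v => ?_
        gcongr
        refine PMF.mean_le_of_le _ fun i => ?_
        rw [nbr_eq]
        cases dart A v i <;> simp [QueryAlg.expectedQueries, one_add_one_eq_two]
    _ = 4 := by norm_num

variable [DecidableRel G.Adj]

/-- An edge out of `v` is drawn with probability `1/(n d(v))`, and the factor `d(v)` of the
estimator cancels the degree. -/
theorem mean_ofReal_degreeSample (T : ℝ) :
    ((edgeDegrees n).output A).mean (fun x => ENNReal.ofReal (degreeSample T x)) =
      ENNReal.ofReal ((∑ e : G.Dart, weight T (A.deg e.fst) (A.deg e.snd)) / n) := by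
  have hn : (0 : ℝ) < n := by exact_mod_cast Nat.pos_of_neZero n
  have hin : ∀ v, ((pick A v).mean fun o => o.elim (ENNReal.ofReal (degreeSample T (0, 0))) fun e =>
      ENNReal.ofReal (degreeSample T (A.deg e.fst, A.deg e.snd))) =
      ∑ e : G.Dart, if e.fst = v then ENNReal.ofReal (weight T (A.deg e.fst) (A.deg e.snd))
        else 0 := by
    intro v
    rw [PMF.mean_fintype, Fintype.sum_option]
    simp only [degreeSample, Nat.cast_zero, zero_mul, Option.elim_none, ENNReal.ofReal_zero, mul_zero, zero_add, Option.elim_some,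
      pick_some]
    refine Finset.sum_congr rfl fun e _ => ?_
    split_ifs with h
    · have hd := deg_pos_of_adj (A := A) e.adj
      rw [← h, ENNReal.ofReal_mul (Nat.cast_nonneg _), ENNReal.ofReal_natCast, ← mul_assoc,
        ENNReal.inv_mul_cancel (by exact_mod_cast hd.ne') (ENNReal.natCast_ne_top _), one_mul]
    · rw [zero_mul]
  rw [mean_edgeDegrees]
  simp only [hin]
  rw [PMF.mean_uniform, Finset.sum_comm, Fintype.card_fin, ENNReal.ofReal_div_of_pos hn,
    ENNReal.ofReal_natCast, ENNReal.div_eq_inv_mul,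
    ENNReal.ofReal_sum_of_nonneg fun e _ => weight_nonneg _ _ _]
  simp

omit [NeZero n] in
theorem deg_eq_degree (v : Fin n) : A.deg v = G.degree v := by
  rw [← SimpleGraph.card_neighborFinset_eq_degree, AdjList.deg,
    ← List.toFinset_card_of_nodup (A.nodup v)]
  congr 1
  ext u
  simp [A.mem_iff]

omit [NeZero n] in
theorem sum_deg : ∑ v, A.deg v = Fintype.card G.Dart := by
  rw [SimpleGraph.dart_card_eq_sum_degrees]
  exact Finset.sum_congr rfl fun v _ => deg_eq_degree A v

-- Reversal of edges symmetrises the sum: the two orientations of an edge have total weight 2, or 0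
-- if both ends are heavy.
omit [NeZero n] in
theorem sum_weight (T : ℝ) :
    ∑ e : G.Dart, weight T (A.deg e.fst) (A.deg e.snd) =
      Fintype.card G.Dart -
        (Finset.univ.filter fun e : G.Dart => T < A.deg e.fst ∧ T < A.deg e.snd).card := by
  have hsymm : ∑ e : G.Dart, weight T (A.deg e.fst) (A.deg e.snd) =
      ∑ e : G.Dart, weight T (A.deg e.snd) (A.deg e.fst) :=
    Fintype.sum_equiv (Equiv.mk SimpleGraph.Dart.symm SimpleGraph.Dart.symm
      SimpleGraph.Dart.symm_symm SimpleGraph.Dart.symm_symm) _ _ fun e => rfl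
  have hpt : ∀ e : G.Dart, weight T (A.deg e.fst) (A.deg e.snd) +
      weight T (A.deg e.snd) (A.deg e.fst) =
      2 * (1 - if T < A.deg e.fst ∧ T < A.deg e.snd then 1 else 0) := by
    intro e
    unfold weight
    by_cases h1 : T < A.deg e.fst <;> by_cases h2 : T < A.deg e.snd <;> simp only [h1, h2] <;> norm_num
  have h2 : 2 * ∑ e : G.Dart, weight T (A.deg e.fst) (A.deg e.snd) =
      2 * ∑ e : G.Dart, ((1 : ℝ) - if T < A.deg e.fst ∧ T < A.deg e.snd then 1 else 0) := by
    rw [two_mul]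
    nth_rewrite 2 [hsymm]
    rw [← Finset.sum_add_distrib, Finset.mul_sum]
    exact Finset.sum_congr rfl fun e _ => hpt e
  rw [mul_left_cancel₀ two_ne_zero h2, Finset.sum_sub_distrib]
  simp

omit [NeZero n] in
theorem sum_weight_le (T : ℝ) :
    ∑ e : G.Dart, weight T (A.deg e.fst) (A.deg e.snd) ≤ Fintype.card G.Dart := by
  rw [sum_weight]
  linarith [Nat.cast_nonneg (α := ℝ)
    (Finset.univ.filter fun e : G.Dart => T < A.deg e.fst ∧ T < A.deg e.snd).card]

omit [NeZero n] in
/-- Edges between vertices of large degree are rare. -/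
theorem le_sum_weight {T : ℝ} (hT : 0 < T) :
    Fintype.card G.Dart - (Fintype.card G.Dart / T) ^ 2 ≤
      ∑ e : G.Dart, weight T (A.deg e.fst) (A.deg e.snd) := by
  classical
  rw [sum_weight]
  set H := Finset.univ.filter fun v : Fin n => T < A.deg v
  -- The heavy vertices alone contribute more than `T` each to the degree sum `m`.
  have hH : (H.card : ℝ) ≤ Fintype.card G.Dart / T := by
    rw [le_div_iff₀ hT, ← sum_deg A, ← nsmul_eq_mul]
    push_cast
    calc H.card • T ≤ ∑ v ∈ H, (A.deg v : ℝ) :=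
          Finset.card_nsmul_le_sum _ _ _ fun v hv => (Finset.mem_filter.1 hv).2.le
      _ ≤ ∑ v, (A.deg v : ℝ) := Finset.sum_le_sum_of_subset_of_nonneg (Finset.subset_univ _)
          fun _ _ _ => Nat.cast_nonneg _
  have hcard : (Finset.univ.filter fun e : G.Dart =>
      T < A.deg e.fst ∧ T < A.deg e.snd).card ≤ (H ×ˢ H).card := by
    refine Finset.card_le_card_of_injOn (fun e => e.toProd) ?_ ?_
    · intro e he
      simpa [H] using he
    · intro e _ e' _ h
      exact SimpleGraph.Dart.ext _ _ h
  have : ((Finset.univ.filter fun e : G.Dart =>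
      T < A.deg e.fst ∧ T < A.deg e.snd).card : ℝ) ≤ (Fintype.card G.Dart / T) ^ 2 := by
    calc _ ≤ ((H ×ˢ H).card : ℝ) := by exact_mod_cast hcard
      _ = (H.card : ℝ) ^ 2 := by rw [Finset.card_product, sq]; push_cast; ring
      _ ≤ _ := by gcongr
  linarith

end EdgeSampler

/-! ### Geometric search for the average degree -/

namespace EdgeSampler

variable {n : ℕ}

/-- The ratio of the degree threshold to the guess `g` for the average degree. -/
def thresholdRatio (n : ℕ) (ε g : ℝ) : ℝ := √(32 * n / (ε * g))

/-- The number of samples for testing the guess `g` for the average degree. -/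
def sampleCount (n : ℕ) (ε L g : ℝ) : ℕ := ⌈20480 * L * thresholdRatio n ε g / ε ^ 2⌉₊

/-- An estimate for the average degree that is reliable if `g` is close to the average degree. -/
def roundEstimate (n : ℕ) (ε L g : ℝ) : QueryAlg n ℝ :=
  ((edgeDegrees n).replicate (sampleCount n ε L g)).bind fun l =>
    .ret ((l.map (degreeSample (g * thresholdRatio n ε g))).sum / sampleCount n ε L g)

/-- Search for an estimate of the average degree with geometrically decreasing guesses. -/
def searchEstimate (n : ℕ) (ε L : ℝ) : ℕ → QueryAlg n (Option ℝ)
  | 0 => .ret none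
  | k + 1 => (roundEstimate n ε L (2 ^ k / n)).bind fun X =>
      open Classical in
      if 2 ^ k / n ≤ X then .ret (some (X / (1 + ε / 8))) else searchEstimate n ε L k

theorem thresholdRatio_anti {ε g g' : ℝ} (hε : 0 < ε) (hg : 0 < g) (h : g ≤ g') :
    thresholdRatio n ε g' ≤ thresholdRatio n ε g :=
  Real.sqrt_le_sqrt (div_le_div_of_nonneg_left (by positivity) (by positivity)
    (mul_le_mul_of_nonneg_left h hε.le))

theorem sampleCount_anti {ε L g g' : ℝ} (hε : 0 < ε) (hL : 0 < L) (hg : 0 < g) (h : g ≤ g') :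
    sampleCount n ε L g' ≤ sampleCount n ε L g := by
  refine Nat.ceil_mono (div_le_div_of_nonneg_right ?_ (by positivity))
  exact mul_le_mul_of_nonneg_left (thresholdRatio_anti hε hg h) (by positivity)

variable [NeZero n] {G : SimpleGraph (Fin n)} [DecidableRel G.Adj] (A : AdjList G)

theorem thresholdRatio_pos {ε g : ℝ} (hε : 0 < ε) (hg : 0 < g) : 0 < thresholdRatio n ε g := by
  have hn : (0 : ℝ) < n := by exact_mod_cast Nat.pos_of_neZero n
  exact Real.sqrt_pos.2 (by positivity)

/-- Chernoff for the estimator scaled by `2T` into `[0, 1]`. The error is relative to the larger of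
guess and truth, so that guesses far too large are also refuted. -/
theorem roundEstimate_good {ε L g : ℝ} (hε : 0 < ε) (hε2 : ε < 1 / 2) (hL : 0 < L) (hg : 0 < g) :
    (roundEstimate n ε L g).prob A (fun X => ¬ |X -
      (∑ e : G.Dart, weight (g * thresholdRatio n ε g) (A.deg e.fst) (A.deg e.snd)) / n| ≤
        ε / 16 * max (avgDeg G) g) ≤ ENNReal.ofReal (2 * Real.exp (-(10 * L))) := by
  classical
  have hn : (0 : ℝ) < n := by exact_mod_cast Nat.pos_of_neZero n
  have hr := thresholdRatio_pos (n := n) hε hg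
  set r := thresholdRatio n ε g
  set T := g * r with hTdef
  have hT : 0 < T := by positivity
  set q := sampleCount n ε L g with hqdef
  have hq : 20480 * L * r / ε ^ 2 ≤ q := Nat.le_ceil _
  have hqpos : (0 : ℝ) < q := lt_of_lt_of_le (by positivity) hq
  set w := (∑ e : G.Dart, weight T (A.deg e.fst) (A.deg e.snd)) / n with hw
  have hw0 : 0 ≤ w := div_nonneg (Finset.sum_nonneg fun e _ => weight_nonneg _ _ _) hn.le
  have hwd : w ≤ max (avgDeg G) g :=
    (div_le_div_of_nonneg_right (sum_weight_le A T) hn.le).trans (le_max_left _ _)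
  set D := max (avgDeg G) g with hD
  have hgD : g ≤ D := le_max_right _ _
  have hμ : ((edgeDegrees n).output A).mean
      (fun x => ENNReal.ofReal (degreeSample T x / (2 * T))) = ENNReal.ofReal (w / (2 * T)) := by
    simp only [ENNReal.ofReal_div_of_pos (show 0 < 2 * T by positivity)]
    simp only [div_eq_mul_inv, PMF.mean_mul_const]
    rw [mean_ofReal_degreeSample]
  have hch := QueryAlg.chernoff A (edgeDegrees n) (fun x => degreeSample T x / (2 * T))
    (fun x => div_nonneg (mul_nonneg (Nat.cast_nonneg _) (weight_nonneg _ _ _)) (by positivity))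
    (fun x => (div_le_one (by positivity)).2 (mul_weight_le hT.le _ _)) (by positivity) hμ q
    (M := q * (D / (2 * T))) (η := ε / 16) (by gcongr) (by positivity) (by linarith)
  rw [roundEstimate, QueryAlg.prob_eq_mean, QueryAlg.mean_output_bind]
  simp only [QueryAlg.output, PMF.mean_pure]
  rw [← QueryAlg.prob_eq_mean]
  refine (QueryAlg.prob_mono A _ fun l hl => ?_).trans (hch.trans ?_)
  · intro h
    apply hl
    have h1 : (l.map fun x => degreeSample T x / (2 * T)).sum =
        (l.map (degreeSample T)).sum / (2 * T) := by
      simp only [div_eq_mul_inv]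
      exact List.sum_map_mul_right _ _ _
    have h2 : (l.map (degreeSample T)).sum / (2 * T) - q * (w / (2 * T)) =
        ((l.map (degreeSample T)).sum / q - w) * (q / (2 * T)) := by
      field_simp
    have h3 : 0 < q / (2 * T) := by positivity
    rw [h1, h2, abs_mul, abs_of_pos h3] at h
    have h4 : ε / 16 * (q * (D / (2 * T))) = ε / 16 * D * (q / (2 * T)) := by ring
    rw [h4] at h
    exact le_of_mul_le_mul_right h h3
  · refine ENNReal.ofReal_le_ofReal (mul_le_mul_of_nonneg_left (Real.exp_le_exp.2 ?_) (by norm_num))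
    -- With `T = g r` and `D ≥ g` the exponent is at least `20480 L / (16² · 2 · 4) = 10 L`.
    have h5 : 20480 * L * r / ε ^ 2 * (g / (2 * T)) ≤ q * (D / (2 * T)) := by gcongr
    have h6 : 20480 * L * r / ε ^ 2 * (g / (2 * T)) = 10240 * L / ε ^ 2 := by
      rw [hTdef]
      field_simp
      norm_num
    have h7 : (ε / 16) ^ 2 * (10240 * L / ε ^ 2) / 4 = 10 * L := by
      field_simp
      norm_num
    have h8 := mul_le_mul_of_nonneg_left (h6 ▸ h5) (sq_nonneg (ε / 16))
    linarith

/-- A guess above `2 d_avg` exceeds its estimate, so acceptance means error at most `ε d_avg / 8`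
around a mean in `[(1 - ε/8) d_avg, d_avg]`; division by `1 + ε/8` makes the result a lower
estimate. A guess at most `d_avg / 2` is below its estimate and cannot be rejected. -/
theorem accept_or_reject {ε g X : ℝ} (hε : 0 < ε) (hε2 : ε < 1 / 2)
    (hd : 0 < avgDeg G) (hg : avgDeg G / 4 < g)
    (hX : |X - (∑ e : G.Dart, weight (g * thresholdRatio n ε g) (A.deg e.fst) (A.deg e.snd)) / n| ≤
        ε / 16 * max (avgDeg G) g) :
    (g ≤ X → (1 - ε) * avgDeg G ≤ X / (1 + ε / 8) ∧ X / (1 + ε / 8) ≤ avgDeg G) ∧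
      (¬ g ≤ X → avgDeg G / 2 < g) := by
  have hn : (0 : ℝ) < n := by exact_mod_cast Nat.pos_of_neZero n
  have hg0 : 0 < g := by linarith
  have hr := thresholdRatio_pos (n := n) hε hg0
  have hr2 : thresholdRatio n ε g ^ 2 = 32 * n / (ε * g) := Real.sq_sqrt (by positivity)
  set r := thresholdRatio n ε g
  have hT : 0 < g * r := by positivity
  have hu := div_le_div_of_nonneg_right (sum_weight_le A (g * r)) hn.le
  have hl := div_le_div_of_nonneg_right (le_sum_weight A hT) hn.le
  rw [← avgDeg] at hu
  set w := (∑ e : G.Dart, weight (g * r) (A.deg e.fst) (A.deg e.snd)) / n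
  set d := avgDeg G with hddef
  have hm : (Fintype.card G.Dart : ℝ) = d * n := by
    rw [hddef, avgDeg]; field_simp
  -- The threshold is chosen so that the lost part `(m/T)²/n` equals `ε d (d/g) / 32`, and `d/g ≤
  -- 4`.
  have hl' : d - ε * d / 8 ≤ w := by
    refine le_trans ?_ hl
    rw [hm, div_pow, mul_pow, mul_pow, hr2]
    have : (d * n - d ^ 2 * n ^ 2 / (g ^ 2 * (32 * n / (ε * g)))) / n =
        d - ε * d * (d / g) / 32 := by
      field_simp
    rw [this]
    have h4 : d / g ≤ 4 := by
      rw [div_le_iff₀ hg0]; linarith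
    have : 0 < ε * d := by positivity
    nlinarith
  have hεd : ε * d ≤ d / 2 := by nlinarith
  have hεd0 : 0 < ε * d := by positivity
  obtain ⟨hX1, hX2⟩ := abs_le.1 hX
  constructor
  · intro hgX
    have hg2 : g ≤ 2 * d := by
      by_contra h
      rw [max_eq_right (by linarith)] at hX2
      nlinarith
    have hmax : max d g ≤ 2 * d := max_le (by linarith) hg2
    have h1 : ε / 16 * max d g ≤ ε * d / 8 := by nlinarith
    constructor
    · rw [le_div_iff₀ (by positivity)]
      nlinarith
    · rw [div_le_iff₀ (by positivity)]
      nlinarith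
  · intro hgX
    by_contra h
    rw [max_eq_left (by linarith)] at hX1
    nlinarith

omit [DecidableRel G.Adj] in
theorem expectedQueries_roundEstimate_le (ε L g : ℝ) :
    (roundEstimate n ε L g).expectedQueries A ≤ sampleCount n ε L g * 4 := by
  rw [roundEstimate, QueryAlg.expectedQueries_bind, QueryAlg.expectedQueries_replicate]
  simp only [QueryAlg.expectedQueries, PMF.mean_const, add_zero]
  gcongr
  exact expectedQueries_edgeDegrees A

omit [NeZero n] in
theorem two_div_le_avgDeg [Nonempty G.Dart] : 2 / (n : ℝ) ≤ avgDeg G := by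
  refine div_le_div_of_nonneg_right ?_ (Nat.cast_nonneg _)
  obtain ⟨e⟩ := ‹Nonempty G.Dart›
  have : 1 < Fintype.card G.Dart :=
    Fintype.one_lt_card_iff.2 ⟨e, e.symm, (SimpleGraph.Dart.symm_ne e).symm⟩
  exact_mod_cast this

/-- The invariant is that the last rejected guess exceeds `d_avg / 2`. Good rounds preserve it, and
a union bound covers the bad ones. -/
theorem searchEstimate_correct [Nonempty G.Dart] {ε L : ℝ} (hε : 0 < ε) (hε2 : ε < 1 / 2)
    (hL : 0 < L) (k : ℕ) (hk : avgDeg G / 2 < 2 ^ k / n) :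
    (searchEstimate n ε L k).prob A
        (fun o => ¬ ∃ d, o = some d ∧ (1 - ε) * avgDeg G ≤ d ∧ d ≤ avgDeg G) ≤
      k * ENNReal.ofReal (2 * Real.exp (-(10 * L))) := by
  classical
  have hn : (0 : ℝ) < n := by exact_mod_cast Nat.pos_of_neZero n
  have hd2 := two_div_le_avgDeg (G := G)
  have hd : 0 < avgDeg G := lt_of_lt_of_le (by positivity) hd2
  induction k with
  -- The invariant cannot reach `k = 0`: an edge has two orientations, so `d_avg ≥ 2/n`.
  | zero =>
    have : 2 / (n : ℝ) = 2 * (2 ^ 0 / n) := by ring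
    linarith
  | succ k ih =>
    have hg : (0 : ℝ) < 2 ^ k / n := by positivity
    have hkg : avgDeg G / 4 < 2 ^ k / n := by
      rw [pow_succ, mul_div_right_comm] at hk
      linarith
    rw [searchEstimate]
    refine (QueryAlg.prob_bind_le A _ _ _ _ fun X hX => ?_).trans
      ((add_le_add_left (roundEstimate_good A hε hε2 hL hg)
        (k * ENNReal.ofReal (2 * Real.exp (-(10 * L))))).trans (le_of_eq ?_))
    · obtain ⟨h1, h2⟩ := accept_or_reject A hε hε2 hd hkg hX
      split_ifs with h
      · have : ∃ d, some (X / (1 + ε / 8)) = some d ∧ (1 - ε) * avgDeg G ≤ d ∧ d ≤ avgDeg G :=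
          ⟨_, rfl, h1 h⟩
        rw [QueryAlg.prob_eq_mean, QueryAlg.output, PMF.mean_pure, if_neg (not_not.2 this)]
        exact zero_le
      · exact ih (h2 h)
    · push_cast
      ring

omit [DecidableRel G.Adj] in
theorem expectedQueries_searchEstimate_le_worst {ε L : ℝ} (hε : 0 < ε) (hL : 0 < L) (k : ℕ) :
    (searchEstimate n ε L k).expectedQueries A ≤ k * (sampleCount n ε L (1 / n) * 4) := by
  classical
  have hn : (0 : ℝ) < n := by exact_mod_cast Nat.pos_of_neZero n
  induction k with
  | zero => simp [searchEstimate, QueryAlg.expectedQueries]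
  | succ k ih =>
    rw [searchEstimate, QueryAlg.expectedQueries_bind]
    have h1 : sampleCount n ε L (2 ^ k / n) ≤ sampleCount n ε L (1 / n) :=
      sampleCount_anti hε hL (by positivity)
        (div_le_div_of_nonneg_right (one_le_pow₀ one_le_two) hn.le)
    calc _ ≤ (sampleCount n ε L (1 / n) * 4 : ℝ≥0∞) +
          k * (sampleCount n ε L (1 / n) * 4) := by
          refine add_le_add ((expectedQueries_roundEstimate_le A _ _ _).trans ?_)
            (PMF.mean_le_of_le _ fun X => ?_)
          · gcongr
          · split_ifs
            · exact zero_le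
            · exact ih
      _ = _ := by push_cast; ring

/-- While all rounds are good, the guesses stay above `d_avg / 4`, which bounds the sample count.
`K` stays fixed during the induction so that each bad round is charged the same worst-case cost. -/
theorem expectedQueries_searchEstimate_le [Nonempty G.Dart] {ε L : ℝ} (hε : 0 < ε)
    (hε2 : ε < 1 / 2) (hL : 0 < L) (K k : ℕ) (hkK : k ≤ K) (hk : avgDeg G / 2 < 2 ^ k / n) :
    (searchEstimate n ε L k).expectedQueries A ≤
      k * (sampleCount n ε L (avgDeg G / 4) * 4 + K * (sampleCount n ε L (1 / n) * 4) *
        ENNReal.ofReal (2 * Real.exp (-(10 * L)))) := by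
  classical
  have hn : (0 : ℝ) < n := by exact_mod_cast Nat.pos_of_neZero n
  have hd2 := two_div_le_avgDeg (G := G)
  have hd : 0 < avgDeg G := lt_of_lt_of_le (by positivity) hd2
  induction k with
  | zero => simp [searchEstimate, QueryAlg.expectedQueries]
  | succ k ih =>
    have hg : (0 : ℝ) < 2 ^ k / n := by positivity
    have hkg : avgDeg G / 4 < 2 ^ k / n := by
      rw [pow_succ, mul_div_right_comm] at hk
      linarith
    rw [searchEstimate]
    refine (QueryAlg.expectedQueries_bind_le A _ _ _
      (c := k * (sampleCount n ε L (avgDeg G / 4) * 4 + K * (sampleCount n ε L (1 / n) * 4) *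
        ENNReal.ofReal (2 * Real.exp (-(10 * L)))))
      (B := K * (sampleCount n ε L (1 / n) * 4)) (fun X hX => ?_) (fun X => ?_)).trans
      ((add_le_add (expectedQueries_roundEstimate_le A _ _ _) (add_le_add_left
        (mul_le_mul_right (roundEstimate_good A hε hε2 hL hg) _) _)).trans ?_)
    · obtain ⟨-, h2⟩ := accept_or_reject A hε hε2 hd hkg hX
      split_ifs with h
      · exact zero_le
      · exact ih (by omega) (h2 h)
    · split_ifs
      · exact zero_le
      · refine (expectedQueries_searchEstimate_le_worst A hε hL k).trans ?_
        gcongr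
        omega
    · have h1 : sampleCount n ε L (2 ^ k / n) ≤ sampleCount n ε L (avgDeg G / 4) :=
        sampleCount_anti hε hL (by positivity) hkg.le
      have h1' : (sampleCount n ε L (2 ^ k / n) : ℝ≥0∞) ≤ sampleCount n ε L (avgDeg G / 4) := by
        exact_mod_cast h1
      refine (add_le_add_left (mul_le_mul_left h1' 4) _).trans (le_of_eq ?_)
      push_cast
      ring

end EdgeSampler

/-! ### Vertex samples and the data array -/

namespace EdgeSampler

variable {n : ℕ}

/-- Draw a random vertex and query its degree. -/
def vertexDegree (n : ℕ) : QueryAlg n (Fin n × ℕ) :=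
  .vertex fun v => .degree v fun d => .ret (v, d)

/-- The data array that is made from a list of vertices and their degrees. -/
def pairData (Θ : ℝ) (l : List (Fin n × ℕ)) : List ℝ :=
  data ((l.map Prod.snd).sum / (Θ * l.length + (l.map Prod.snd).sum)) Θ
    (l.flatMap fun p => List.replicate p.2 p.1)

/-- The trade-off parameter after truncation. -/
def cappedTradeoff (n : ℕ) (x d : ℝ) : ℝ := min x √((n : ℝ) / d)

/-- The number of vertices in one sample. -/
def sampleSize (n : ℕ) (ε L x d : ℝ) : ℕ := ⌈160 * L * n / (cappedTradeoff n x d * d * ε)⌉₊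

/-- Make a data array from an estimate `d` of the average degree: take several samples of
vertices, and use the first one with a small sum of degrees. -/
def buildData (n : ℕ) (ε L x d : ℝ) : QueryAlg n (Option (ℝ × List ℝ)) :=
  open Classical in
  -- Every correct estimate passes this test; it bounds the cost when the estimate is wrong.
  if 1 / n ≤ d ∧ d ≤ n then
    (((vertexDegree n).replicate (sampleSize n ε L x d)).replicate ⌈4 * L⌉₊).bind fun ls =>
      .ret ((ls.find? fun l => ((l.map Prod.snd).sum : ℝ) ≤
        2 * (cappedTradeoff n x d * d / ε) * l.length).map fun l =>
          (d, pairData (cappedTradeoff n x d * d / ε) l))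
  else .ret none

theorem one_le_cappedTradeoff {x d : ℝ} (hx : 1 < x) (hd : 0 < d) (hdn : d ≤ n) :
    1 ≤ cappedTradeoff n x d :=
  le_min hx.le (Real.one_le_sqrt.2 ((one_le_div hd).2 hdn))

variable [NeZero n] {G : SimpleGraph (Fin n)} (A : AdjList G)

theorem mean_vertexDegree (g : Fin n × ℕ → ℝ≥0∞) :
    ((vertexDegree n).output A).mean g = (n : ℝ≥0∞)⁻¹ * ∑ v, g (v, A.deg v) := by
  simp only [vertexDegree, QueryAlg.output, PMF.mean_bind, PMF.mean_pure]
  rw [PMF.mean_uniform, Fintype.card_fin]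

theorem expectedQueries_vertexDegree : (vertexDegree n).expectedQueries A = 2 := by
  simp only [vertexDegree, QueryAlg.expectedQueries, add_zero]
  rw [← one_add_one_eq_two]
  congr 1
  exact PMF.mean_const _ _

theorem expectedQueries_buildData_le (ε L x d : ℝ) :
    (buildData n ε L x d).expectedQueries A ≤ ⌈4 * L⌉₊ * (sampleSize n ε L x d * 2) := by
  rw [buildData]
  split_ifs
  · rw [QueryAlg.expectedQueries_bind, QueryAlg.expectedQueries_replicate,
      QueryAlg.expectedQueries_replicate, expectedQueries_vertexDegree]
    simp only [QueryAlg.expectedQueries, PMF.mean_const, add_zero, le_refl]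
  · exact zero_le

omit [NeZero n] in
theorem pairData_eq {Θ : ℝ} {l : List (Fin n × ℕ)} (h : ∀ p ∈ l, p.2 = A.deg p.1) :
    pairData Θ l = sampleData A Θ (l.map Prod.fst) := by
  have h1 : (l.map Prod.snd).sum = degSum A (l.map Prod.fst) := by
    rw [degSum, List.map_map]
    congr 1
    exact List.map_congr_left h
  have h2 : l.flatMap (fun p => List.replicate p.2 p.1) = repeatByDegree A (l.map Prod.fst) := by
    rw [repeatByDegree, List.flatMap_map]
    exact List.flatMap_congr fun p hp => by rw [h p hp]
  rw [pairData, sampleData, branchProb, h1, h2, List.length_map]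

variable [DecidableRel G.Adj]

/-- The properties of a sample that hold with overwhelming probability. -/
structure IsAccurate (η Θ : ℝ) (s : ℕ) (l : List (Fin n × ℕ)) : Prop where
  length_eq : l.length = s
  snd_eq : ∀ p ∈ l, p.2 = A.deg p.1
  adjCount_close : ∀ u, Θ < A.deg u →
    |(adjCount G (l.map Prod.fst) u : ℝ) - s * (A.deg u / n)| ≤ η * (s * (A.deg u / n))

/-- A uniform vertex is a neighbor of `u` with probability `d(u)/n`; the Chernoff bound applies to
these indicators. -/
theorem prob_adjCount (u : Fin n) (s : ℕ) {η : ℝ} (hη0 : 0 ≤ η) (hη : η ≤ 2) :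
    ((vertexDegree n).replicate s).prob A (fun l =>
      ¬ |(adjCount G (l.map Prod.fst) u : ℝ) - s * (A.deg u / n)| ≤ η * (s * (A.deg u / n))) ≤
      ENNReal.ofReal (2 * Real.exp (-(η ^ 2 * (s * (A.deg u / n)) / 4))) := by
  have hn : (0 : ℝ) < n := by exact_mod_cast Nat.pos_of_neZero n
  have hsum : ∀ l : List (Fin n × ℕ), (l.map fun p => if G.Adj p.1 u then (1 : ℝ) else 0).sum =
      adjCount G (l.map Prod.fst) u := by
    intro l
    rw [adjCount, List.map_map]
    push_cast
    rw [List.map_map]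
    congr 2
    ext p
    simp
  have := QueryAlg.chernoff A (vertexDegree n) (fun p => if G.Adj p.1 u then (1 : ℝ) else 0)
    (fun p => by split_ifs <;> norm_num) (fun p => by split_ifs <;> norm_num)
    (μ := A.deg u / n) (M := s * (A.deg u / n)) (by positivity) ?_ s le_rfl hη0 hη
  · simpa only [hsum] using this
  · rw [mean_vertexDegree, deg_eq_degree, ENNReal.ofReal_div_of_pos hn, ENNReal.ofReal_natCast,
      ENNReal.ofReal_natCast, ENNReal.div_eq_inv_mul]
    congr 1
    have : ∀ v, ENNReal.ofReal (if G.Adj v u then 1 else 0) = if G.Adj v u then 1 else 0 := by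
      intro v; split_ifs <;> simp
    simp only [this]
    rw [Finset.sum_boole, ← SimpleGraph.card_neighborFinset_eq_degree]
    congr 2
    ext v
    simp [G.adj_comm]

/-- Union bound over the heavy vertices: degree above `Θ` makes the expected count large enough for
the exponent `c`. -/
theorem prob_not_isAccurate {η Θ c : ℝ} (s : ℕ) (hη0 : 0 ≤ η) (hη : η ≤ 2)
    (hs : c ≤ η ^ 2 * (s * (Θ / n)) / 4) :
    ((vertexDegree n).replicate s).prob A (fun l => ¬ IsAccurate A η Θ s l) ≤
      n * ENNReal.ofReal (2 * Real.exp (-c)) := by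
  classical
  have hn : (0 : ℝ) < n := by exact_mod_cast Nat.pos_of_neZero n
  have hdeg : ((vertexDegree n).replicate s).prob A (fun l => ∃ p ∈ l, p.2 ≠ A.deg p.1) = 0 := by
    refine le_antisymm ((QueryAlg.prob_exists_replicate_le A _ _ _).trans ?_) zero_le
    rw [QueryAlg.prob_eq_mean, mean_vertexDegree]
    simp
  set H := Finset.univ.filter fun u : Fin n => Θ < A.deg u
  calc _ ≤ ((vertexDegree n).replicate s).prob A (fun l => l.length ≠ s ∨
        ((∃ p ∈ l, p.2 ≠ A.deg p.1) ∨ ∃ u ∈ H,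
          ¬ |(adjCount G (l.map Prod.fst) u : ℝ) - s * (A.deg u / n)| ≤
            η * (s * (A.deg u / n)))) := by
        refine QueryAlg.prob_mono A _ fun l hl => ?_
        by_contra h
        push Not at h
        exact hl ⟨h.1, h.2.1, fun u hu => h.2.2 u (by simpa [H] using hu)⟩
    _ ≤ 0 + (0 + ∑ u ∈ H, ENNReal.ofReal (2 * Real.exp (-c))) := by
        refine (QueryAlg.prob_or_le A _ _ _).trans (add_le_add
          (QueryAlg.prob_length_replicate A _ _).le ((QueryAlg.prob_or_le A _ _ _).trans
            (add_le_add hdeg.le ((QueryAlg.prob_exists_le A _ _ _).trans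
              (Finset.sum_le_sum fun u hu => ?_)))))
        refine (prob_adjCount A u s hη0 hη).trans (ENNReal.ofReal_le_ofReal ?_)
        have hu' : Θ ≤ A.deg u := (Finset.mem_filter.1 hu).2.le
        have : η ^ 2 * (s * (Θ / n)) / 4 ≤ η ^ 2 * (s * (A.deg u / n)) / 4 := by gcongr
        refine mul_le_mul_of_nonneg_left (Real.exp_le_exp.2 ?_) (by norm_num)
        linarith
    _ ≤ _ := by
        rw [zero_add, zero_add, Finset.sum_const, nsmul_eq_mul]
        gcongr
        exact (Finset.card_le_univ H).trans (by simp)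

/-- A sample rarely has a sum of degrees far above the average. -/
theorem prob_degSum {Θ : ℝ} (hΘ : 0 < Θ) (hd : avgDeg G ≤ Θ) {s : ℕ} (hs : 0 < s) :
    ((vertexDegree n).replicate s).prob A (fun l =>
      ¬ ((l.map Prod.snd).sum : ℝ) ≤ 2 * Θ * l.length) ≤ 2⁻¹ := by
  classical
  have hn : (0 : ℝ) < n := by exact_mod_cast Nat.pos_of_neZero n
  have hs' : (0 : ℝ) < s := by exact_mod_cast hs
  have hmean : ((vertexDegree n).output A).mean (fun p => (p.2 : ℝ≥0∞)) =
      ENNReal.ofReal (avgDeg G) := by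
    rw [mean_vertexDegree, avgDeg, ENNReal.ofReal_div_of_pos hn, ENNReal.ofReal_natCast,
      ENNReal.ofReal_natCast, ENNReal.div_eq_inv_mul, ← sum_deg A, Nat.cast_sum]
  have hmarkov := QueryAlg.markov A ((vertexDegree n).replicate s)
    -- The fixed sample size `s` is used first, because Markov's inequality compares with a
    -- constant.
    (fun l => ¬ ((l.map Prod.snd).sum : ℝ) ≤ 2 * Θ * s)
    (fun l => (l.map fun p => (p.2 : ℝ≥0∞)).sum) (c := ENNReal.ofReal (2 * Θ * s)) (fun l hl => by
      have : (l.map fun p => (p.2 : ℝ≥0∞)).sum = ((l.map Prod.snd).sum : ℕ) := by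
        push_cast
        rw [List.map_map]
        rfl
      rw [this, ← ENNReal.ofReal_natCast]
      exact ENNReal.ofReal_le_ofReal (not_le.1 hl).le)
  rw [QueryAlg.mean_sum_replicate, hmean] at hmarkov
  have h2 : ((vertexDegree n).replicate s).prob A
      (fun l => ¬ ((l.map Prod.snd).sum : ℝ) ≤ 2 * Θ * s) ≤ 2⁻¹ := by
    have hpos : 0 < 2 * Θ * s := by positivity
    rw [mul_comm, ← ENNReal.le_div_iff_mul_le (Or.inl (by simpa using hpos)) (Or.inl (by simp)),
      ← ENNReal.ofReal_natCast s, ← ENNReal.ofReal_mul hs'.le,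
      ← ENNReal.ofReal_div_of_pos hpos] at hmarkov
    refine hmarkov.trans ?_
    rw [show (2 : ℝ≥0∞) = ENNReal.ofReal 2 by simp, ← ENNReal.ofReal_inv_of_pos two_pos]
    refine ENNReal.ofReal_le_ofReal ?_
    rw [div_le_iff₀ hpos]
    nlinarith
  calc _ ≤ ((vertexDegree n).replicate s).prob A (fun l => l.length ≠ s ∨
        ¬ ((l.map Prod.snd).sum : ℝ) ≤ 2 * Θ * s) := by
        refine QueryAlg.prob_mono A _ fun l hl => ?_
        by_cases h : l.length = s
        · right; rwa [h] at hl
        · left; exact h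
    _ ≤ 0 + 2⁻¹ := (QueryAlg.prob_or_le A _ _ _).trans
        (add_le_add (QueryAlg.prob_length_replicate A _ _).le h2)
    _ = _ := zero_add _

theorem buildData_correct [Nonempty G.Dart] {ε L x d C : ℝ} (hε : 0 < ε) (hε2 : ε < 1 / 2)
    (hL : 0 < L) (hx : 1 < x) (hC : 84 ≤ C) (hd1 : (1 - ε) * avgDeg G ≤ d) (hd2 : d ≤ avgDeg G)
    (hd3 : 1 / n ≤ d) (hd4 : d ≤ n) :
    (buildData n ε L x d).prob A (fun o => ¬ Successful A program C ε x o) ≤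
      2⁻¹ ^ ⌈4 * L⌉₊ + ⌈4 * L⌉₊ * (n * ENNReal.ofReal (2 * Real.exp (-(10 * L)))) := by
  classical
  have hn : (0 : ℝ) < n := by exact_mod_cast Nat.pos_of_neZero n
  have hd : 0 < d := lt_of_lt_of_le (by positivity) hd3
  have hxb := one_le_cappedTradeoff hx hd hd4
  rw [buildData, if_pos ⟨hd3, hd4⟩]
  set xb := cappedTradeoff n x d with hxbdef
  set s := sampleSize n ε L x d with hsdef
  set Θ := xb * d / ε with hΘdef
  have hΘ : 0 < Θ := by positivity
  have hs : 160 * L * n / (xb * d * ε) ≤ s := Nat.le_ceil _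
  have hs0 : (0 : ℝ) < s := lt_of_lt_of_le (by positivity) hs
  have hsN : 0 < s := by exact_mod_cast hs0
  have hda : 0 < avgDeg G := hd.trans_le hd2
  -- Uses `x̄ ≥ 1` and `d ≥ (1 - ε) d_avg ≥ ε d_avg`, where `ε < 1/2` enters.
  have hΘd : avgDeg G ≤ Θ := by
    rw [hΘdef, le_div_iff₀ hε]
    nlinarith
  -- The product of sample size and threshold is independent of `x̄` and `d`; the factor 160 yields
  -- the exponent `10 L`.
  have hacc : 10 * L ≤ (ε / 2) ^ 2 * (s * (Θ / n)) / 4 := by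
    have h1 : 160 * L * n / (xb * d * ε) * (Θ / n) ≤ s * (Θ / n) := by gcongr
    have h2 : 160 * L * n / (xb * d * ε) * (Θ / n) = 160 * L / ε ^ 2 := by
      rw [hΘdef]
      field_simp
    have h3 : (ε / 2) ^ 2 * (160 * L / ε ^ 2) / 4 = 10 * L := by
      field_simp
      norm_num
    have h4 := mul_le_mul_of_nonneg_left (h2 ▸ h1) (sq_nonneg (ε / 2))
    linarith
  rw [QueryAlg.prob_eq_mean, QueryAlg.mean_output_bind]
  simp only [QueryAlg.output, PMF.mean_pure]
  rw [← QueryAlg.prob_eq_mean]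
  -- All samples must be accurate, since selection by degree sum would bias a single one.
  calc _ ≤ (((vertexDegree n).replicate s).replicate ⌈4 * L⌉₊).prob A (fun ls =>
        (∀ l ∈ ls, ¬ ((l.map Prod.snd).sum : ℝ) ≤ 2 * Θ * l.length) ∨
          ∃ l ∈ ls, ¬ IsAccurate A (ε / 2) Θ s l) := by
        refine QueryAlg.prob_mono A _ fun ls hls => ?_
        by_contra h
        push Not at h
        obtain ⟨⟨l₀, hl₀, hl₀'⟩, hall⟩ := h
        apply hls
        obtain ⟨l, hl⟩ : ∃ l, (ls.find? fun l => ((l.map Prod.snd).sum : ℝ) ≤ 2 * Θ * l.length) =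
            some l := by
          rw [← Option.isSome_iff_exists, List.find?_isSome]
          exact ⟨l₀, hl₀, by simpa using hl₀'⟩
        have hmem := List.mem_of_find?_eq_some hl
        have hcond : ((l.map Prod.snd).sum : ℝ) ≤ 2 * Θ * l.length := by
          simpa using List.find?_some hl
        have hgood := hall l hmem
        rw [hl, Option.map_some, pairData_eq A hgood.snd_eq]
        have hsample : IsGoodSample A (ε / 2) Θ (l.map Prod.fst) := by
          constructor
          · rw [← List.length_pos_iff, List.length_map, hgood.length_eq]
            exact hsN
          · have h1 : (l.map Prod.snd).sum = degSum A (l.map Prod.fst) := by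
              rw [degSum, List.map_map]
              congr 1
              exact List.map_congr_left hgood.snd_eq
            rw [← h1, List.length_map]
            exact hcond
          · intro u hu
            have := hgood.adjCount_close u hu
            rwa [List.length_map, hgood.length_eq, mul_div_assoc]
        obtain ⟨hP, htime⟩ := sampling_correct hε hε2 hΘ hsample
        have htime' : program.expectedTime A (sampleData A Θ (l.map Prod.fst)) ≤
            ENNReal.ofReal (C * (min x √((n : ℝ) / d) / ε)) := by
          refine htime.trans (ENNReal.ofReal_le_ofReal ?_)
          change _ ≤ C * (xb / ε)
          rw [hΘdef]
          calc 84 * (xb * d / ε) / avgDeg G = 84 * (xb / ε) * (d / avgDeg G) := by ring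
            _ ≤ 84 * (xb / ε) * 1 := by
                gcongr
                exact (div_le_one hda).2 hd2
            _ ≤ C * (xb / ε) := by
                rw [mul_one]
                gcongr
        exact ⟨⟨hd1, hd2⟩, hP,
          (Program.expectedQueries_le_expectedTime _ _ _).trans htime', htime'⟩
    _ ≤ _ := by
        refine (QueryAlg.prob_or_le A _ _ _).trans (add_le_add ?_ ?_)
        · rw [QueryAlg.prob_forall_replicate]
          exact pow_le_pow_left₀ zero_le (prob_degSum A hΘ hΘd hsN) _
        · refine (QueryAlg.prob_exists_replicate_le A _ _ _).trans ?_
          gcongr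
          exact prob_not_isAccurate A s (by positivity) (by linarith) hacc

end EdgeSampler

/-! ### Failure probability and elementary estimates -/

namespace EdgeSampler

/-- The preprocessing procedure: estimate the average degree, and then build the data array. -/
def preprocess (n : ℕ) (ε δ x : ℝ) : QueryAlg n (Option (ℝ × List ℝ)) :=
  (searchEstimate n ε (Real.log (n / δ)) (⌈4 * Real.log (n / δ)⌉₊ + 1)).bind fun o =>
    o.elim (.ret none) fun d => buildData n ε (Real.log (n / δ)) x d

section Numerics

variable {n : ℕ} {δ L : ℝ}

theorem exp_neg_log (hn : 2 ≤ n) (hδ : 0 < δ) :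
    Real.exp (-Real.log (n / δ)) = δ / n := by
  have hn' : (0 : ℝ) < n := by positivity
  rw [Real.exp_neg, Real.exp_log (by positivity), inv_div]

theorem one_le_two_mul_log (hn : 2 ≤ n) (hδ : 0 < δ) (hδ1 : δ < 1) :
    1 ≤ 2 * Real.log (n / δ) := by
  have hn' : (2 : ℝ) ≤ n := by exact_mod_cast hn
  have h : Real.log 2 ≤ Real.log (n / δ) := by
    refine Real.log_le_log two_pos ?_
    rw [le_div_iff₀ hδ]
    nlinarith
  linarith [Real.log_two_gt_d9]

/-- From `log 2 > 1/2`. It bounds the failure of all degree-sum tests and also the first guess of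
the search. -/
theorem exp_two_mul_le_two_pow {L : ℝ} {k : ℕ} (hk : 4 * L ≤ k) :
    Real.exp (2 * L) ≤ 2 ^ k := by
  rw [← Real.exp_log (show (0 : ℝ) < 2 ^ k by positivity), Real.log_pow]
  refine Real.exp_le_exp.2 ?_
  nlinarith [Real.log_two_gt_d9, Nat.cast_nonneg (α := ℝ) k]

/-- With `z = exp (-L) = δ/n`, the repetitions fail with probability at most `z²`, and in the other
terms the power `z^10` absorbs the factors `L` and `n`. The total is at most `z ≤ δ`. -/
theorem failure_le (hn : 2 ≤ n) (hδ : 0 < δ) (hδ1 : δ < 1) :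
    ((⌈4 * Real.log (n / δ)⌉₊ + 1 : ℕ) : ℝ) * (2 * Real.exp (-(10 * Real.log (n / δ)))) +
      ((1 / 2) ^ ⌈4 * Real.log (n / δ)⌉₊ + (⌈4 * Real.log (n / δ)⌉₊ : ℝ) *
        (n * (2 * Real.exp (-(10 * Real.log (n / δ)))))) ≤ δ := by
  have hn' : (2 : ℝ) ≤ n := by exact_mod_cast hn
  have hL := one_le_two_mul_log hn hδ hδ1
  have hexp := exp_neg_log hn hδ
  set L := Real.log (n / δ) with hLdef
  set R := ⌈4 * L⌉₊
  have hR1 : 4 * L ≤ R := Nat.le_ceil _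
  have hR2 : (R : ℝ) ≤ 4 * L + 1 := (Nat.ceil_lt_add_one (by linarith)).le
  set z := Real.exp (-L) with hz
  have hz0 : 0 < z := Real.exp_pos _
  have hzδ : z * n = δ := by rw [hexp]; field_simp
  have hz2 : z ≤ 1 / 2 := by
    rw [hexp, div_le_iff₀ (by linarith)]
    linarith
  have hLz : L * z ≤ 1 := by
    have h1 : L + 1 ≤ Real.exp L := Real.add_one_le_exp L
    have h2 : Real.exp L * z = 1 := by rw [hz, ← Real.exp_add]; simp
    nlinarith
  have h10 : Real.exp (-(10 * L)) = z ^ 10 := by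
    rw [hz, ← Real.exp_nat_mul]
    congr 1
    push_cast
    ring
  have hpow : ((1 : ℝ) / 2) ^ R ≤ z ^ 2 := by
    have h1 := exp_two_mul_le_two_pow hR1
    have h2 : z ^ 2 * Real.exp (2 * L) = 1 := by
      rw [hz, ← Real.exp_nat_mul, ← Real.exp_add]
      push_cast
      rw [show (2 : ℝ) * -L + 2 * L = 0 by ring, Real.exp_zero]
    rw [one_div, inv_pow, inv_eq_one_div, div_le_iff₀ (by positivity)]
    nlinarith [sq_nonneg z]
  have hz8 : z ^ 8 ≤ 1 / 256 := by
    calc z ^ 8 ≤ (1 / 2) ^ 8 := by gcongr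
      _ = 1 / 256 := by norm_num
  have hRz : ((R : ℝ) + 1) * z ≤ 8 := by nlinarith
  have hRz' : (R : ℝ) * z ≤ 6 := by nlinarith
  rw [h10]
  push_cast
  have e1 : ((R : ℝ) + 1) * (2 * z ^ 10) ≤ z / 16 := by
    calc ((R : ℝ) + 1) * (2 * z ^ 10) = 2 * (((R : ℝ) + 1) * z) * (z ^ 8 * z) := by ring
      _ ≤ 2 * 8 * (1 / 256 * z) := by gcongr
      _ = z / 16 := by ring
  have e2 : (R : ℝ) * (n * (2 * z ^ 10)) ≤ z / 10 := by
    calc (R : ℝ) * (n * (2 * z ^ 10)) = 2 * (R * z) * (z * n) * (z ^ 8) := by ring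
      _ ≤ 2 * 6 * 1 * (z ^ 8) := by
          rw [hzδ]
          gcongr
      _ = 12 * z * (z ^ 7) := by ring
      _ ≤ 12 * z * ((1 / 2) ^ 7) := by gcongr
      _ ≤ z / 10 := by linarith
  have e3 : z ≤ δ := by nlinarith
  nlinarith

/-- The bound on the expected number of queries, without the constant. -/
def budget (n : ℕ) (ε L x d : ℝ) : ℝ :=
  max ((n : ℝ) / (d * x)) √((n : ℝ) / d) * (L ^ 2 / ε ^ (5 / 2 : ℝ))

variable {ε x d : ℝ}

/-- `ε²` comes from the Chernoff bound, `√ε` from the threshold ratio. -/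
theorem rpow_five_halves (hε : 0 < ε) : ε ^ (5 / 2 : ℝ) = ε ^ 2 * √ε := by
  rw [show (5 / 2 : ℝ) = 2 + 1 / 2 by norm_num, Real.rpow_add hε, ← Real.sqrt_eq_rpow]
  norm_cast

theorem one_le_inv_rpow (hε : 0 < ε) (hε1 : ε < 1) : 1 ≤ 1 / ε ^ (5 / 2 : ℝ) :=
  (one_le_div (Real.rpow_pos_of_pos hε _)).2 (Real.rpow_le_one hε.le hε1.le (by norm_num))

theorem sampleCount_le (hε : 0 < ε) (hL : 0 ≤ L) (hd : 0 < d) {c : ℝ} (hc : 0 ≤ c) {r : ℝ}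
    (hr : 0 ≤ r) (h : 32 * (n : ℝ) / d ≤ (c * r) ^ 2) :
    (sampleCount n ε L d : ℝ) ≤ 20480 * c * (L * r * (1 / ε ^ (5 / 2 : ℝ))) + 1 := by
  have hsq : thresholdRatio n ε d ≤ c * r / √ε := by
    have : 32 * (n : ℝ) / (ε * d) = 32 * n / d / ε := by field_simp
    rw [thresholdRatio, this, Real.sqrt_div' _ hε.le]
    gcongr
    exact Real.sqrt_le_iff.2 ⟨by positivity, h⟩
  refine (Nat.ceil_lt_add_one (by unfold thresholdRatio; positivity)).le.trans ?_
  have hs : 0 < √ε := Real.sqrt_pos.2 hε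
  rw [rpow_five_halves hε]
  refine add_le_add_left ?_ 1
  calc 20480 * L * thresholdRatio n ε d / ε ^ 2 ≤ 20480 * L * (c * r / √ε) / ε ^ 2 := by gcongr
    _ = _ := by field_simp

end Numerics

end EdgeSampler

/-! ### The total number of queries -/

namespace EdgeSampler

variable {n : ℕ} {δ L ε x d : ℝ}

theorem sampleSize_le (hε : 0 < ε) (hε1 : ε < 1) (hL : 0 ≤ L) (hd : 0 < d) (hx : 0 < x)
    (hn : 0 < n) {B : ℝ} (hB : (n : ℝ) / (cappedTradeoff n x d * d) ≤ B) :
    (sampleSize n ε L x d : ℝ) ≤ 160 * (L * B * (1 / ε ^ (5 / 2 : ℝ))) + 1 := by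
  have hn' : (0 : ℝ) < n := by exact_mod_cast hn
  have hxb : 0 < cappedTradeoff n x d := lt_min hx (Real.sqrt_pos.2 (by positivity))
  have hE : 1 / ε ≤ 1 / ε ^ (5 / 2 : ℝ) := by
    refine one_div_le_one_div_of_le (Real.rpow_pos_of_pos hε _) ?_
    calc ε ^ (5 / 2 : ℝ) ≤ ε ^ (1 : ℝ) :=
          Real.rpow_le_rpow_of_exponent_ge hε hε1.le (by norm_num)
      _ = ε := Real.rpow_one ε
  refine (Nat.ceil_lt_add_one (by positivity)).le.trans (add_le_add_left ?_ 1)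
  have hB0 : 0 ≤ B := le_trans (by positivity) hB
  calc 160 * L * n / (cappedTradeoff n x d * d * ε) =
        160 * (L * (n / (cappedTradeoff n x d * d)) * (1 / ε)) := by field_simp
    _ ≤ _ := by gcongr

theorem div_cappedTradeoff_le_sq (hx : 1 < x) (hn : 0 < n) (hd3 : 1 / (n : ℝ) ≤ d) (hd4 : d ≤ n) :
    (n : ℝ) / (cappedTradeoff n x d * d) ≤ n ^ 2 := by
  have hn' : (0 : ℝ) < n := by exact_mod_cast hn
  have hd : 0 < d := lt_of_lt_of_le (by positivity) hd3
  have hxb := one_le_cappedTradeoff hx hd hd4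
  have h1 : 1 ≤ d * n := (div_le_iff₀ hn').1 hd3
  rw [div_le_iff₀ (by positivity)]
  calc (n : ℝ) = n * 1 * 1 := by ring
    _ ≤ n * cappedTradeoff n x d * (d * n) := by gcongr
    _ = _ := by ring

/-- The minimum in `x̄` becomes the maximum in the budget: for `x̄ = √(n/d)` the left side is again
`√(n/d)`. -/
theorem div_cappedTradeoff_le {d₀ : ℝ} (hx : 1 < x) (hn : 0 < n) (hd₀ : 0 < d₀) (hd : d₀ / 2 ≤ d) :
    (n : ℝ) / (cappedTradeoff n x d * d) ≤ 2 * max ((n : ℝ) / (d₀ * x)) √((n : ℝ) / d₀) := by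
  have hn' : (0 : ℝ) < n := by exact_mod_cast hn
  have hdp : 0 < d := by linarith
  have hx0 : 0 < x := by linarith
  rcases min_cases x √((n : ℝ) / d) with ⟨h, -⟩ | ⟨h, -⟩
  · rw [cappedTradeoff, h]
    refine le_trans ?_ (mul_le_mul_of_nonneg_left (le_max_left _ _) two_pos.le)
    rw [div_le_iff₀ (by positivity)]
    calc (n : ℝ) = 2 * (n / (d₀ * x)) * (x * (d₀ / 2)) := by field_simp
      _ ≤ _ := by gcongr
  · rw [cappedTradeoff, h]
    refine le_trans ?_ (mul_le_mul_of_nonneg_left (le_max_right _ _) two_pos.le)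
    have hs : 0 < √((n : ℝ) / d) := Real.sqrt_pos.2 (by positivity)
    have h1 : (n : ℝ) / (√((n : ℝ) / d) * d) = √((n : ℝ) / d) := by
      rw [div_eq_iff (by positivity), ← mul_assoc, Real.mul_self_sqrt (by positivity)]
      field_simp
    rw [h1]
    refine Real.sqrt_le_iff.2 ⟨by positivity, ?_⟩
    rw [mul_pow, Real.sq_sqrt (by positivity)]
    calc (n : ℝ) / d ≤ n / (d₀ / 2) := by gcongr
      _ = 2 * (n / d₀) := by field_simp
      _ ≤ 2 ^ 2 * (n / d₀) := by gcongr; norm_num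

/-- The index 1 marks typical sizes and 2 worst-case sizes. The latter come with `z^10`, which
cancels their powers of `N` and the surplus `L`. -/
theorem total_le {Z E z N R K q₁ q₂ s₁ s₂ : ℝ} (hL : 1 ≤ 2 * L) (hZ : 1 ≤ Z) (hE : 1 ≤ E)
    (hz0 : 0 ≤ z) (hz1 : z ≤ 1) (hN : 0 ≤ N) (hLz : L * z ≤ 1) (hNz : N * z ≤ 1)
    (hK0 : 0 ≤ K) (hq₁0 : 0 ≤ q₁) (hq₂0 : 0 ≤ q₂) (hs₁0 : 0 ≤ s₁) (hs₂0 : 0 ≤ s₂)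
    (hR : R ≤ 6 * L) (hK : K ≤ 8 * L)
    (hq₁ : q₁ ≤ 245762 * (L * Z * E)) (hq₂ : q₂ ≤ 122882 * (L * N * E))
    (hs₁ : s₁ ≤ 322 * (L * Z * E)) (hs₂ : s₂ ≤ 162 * (L * N ^ 2 * E)) :
    K * (q₁ * 4 + K * (q₂ * 4) * (2 * z ^ 10)) +
      (R * (s₂ * 2) * (K * (2 * z ^ 10)) + R * (s₁ * 2)) ≤ 100000000 * (Z * (L ^ 2 * E)) := by
  have hL0 : 0 < L := by linarith
  have h1 : K * (q₁ * 4) ≤ 7864384 * (Z * (L ^ 2 * E)) := by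
    calc K * (q₁ * 4) ≤ 8 * L * (245762 * (L * Z * E) * 4) := by gcongr
      _ = _ := by ring
  have h2 : K * (K * (q₂ * 4) * (2 * z ^ 10)) ≤ 62915584 * (Z * (L ^ 2 * E)) := by
    calc K * (K * (q₂ * 4) * (2 * z ^ 10)) ≤
          8 * L * (8 * L * (122882 * (L * N * E) * 4) * (2 * z ^ 10)) := by gcongr
      _ = 62915584 * ((L * z) * (N * z) * z ^ 8 * (L ^ 2 * E)) := by ring
      _ ≤ 62915584 * (1 * 1 * 1 * (L ^ 2 * E)) := by
          have := pow_le_one₀ hz0 hz1 (n := 8)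
          gcongr
      _ ≤ 62915584 * (Z * (L ^ 2 * E)) := by
          rw [one_mul, one_mul]
          gcongr
  have h3 : R * (s₂ * 2) * (K * (2 * z ^ 10)) ≤ 31104 * (Z * (L ^ 2 * E)) := by
    calc R * (s₂ * 2) * (K * (2 * z ^ 10)) ≤
          6 * L * (162 * (L * N ^ 2 * E) * 2) * (8 * L * (2 * z ^ 10)) := by gcongr
      _ = 31104 * ((L * z) * (N * z) ^ 2 * z ^ 7 * (L ^ 2 * E)) := by ring
      _ ≤ 31104 * (1 * 1 ^ 2 * 1 * (L ^ 2 * E)) := by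
          have := pow_le_one₀ hz0 hz1 (n := 7)
          gcongr
      _ ≤ 31104 * (Z * (L ^ 2 * E)) := by
          rw [one_pow, one_mul, one_mul]
          gcongr
  have h4 : R * (s₁ * 2) ≤ 3864 * (Z * (L ^ 2 * E)) := by
    calc R * (s₁ * 2) ≤ 6 * L * (322 * (L * Z * E) * 2) := by gcongr
      _ = _ := by ring
  have h5 : 0 ≤ Z * (L ^ 2 * E) := by positivity
  linarith

variable [NeZero n] {G : SimpleGraph (Fin n)} [DecidableRel G.Adj] (A : AdjList G)

omit [NeZero n] [DecidableRel G.Adj] in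
theorem two_le_card [h : Nonempty G.Dart] : 2 ≤ n := by
  obtain ⟨e⟩ := h
  have := Fintype.one_lt_card_iff.2 ⟨e.fst, e.snd, e.adj.ne⟩
  rwa [Fintype.card_fin] at this

theorem avgDeg_le : avgDeg G ≤ n := by
  have hn : (0 : ℝ) < n := by exact_mod_cast Nat.pos_of_neZero n
  rw [avgDeg, div_le_iff₀ hn, SimpleGraph.dart_card_eq_sum_degrees]
  have : ∑ v, G.degree v ≤ ∑ _v : Fin n, n :=
    Finset.sum_le_sum fun v _ => (G.degree_lt_card_verts v).le.trans (by simp)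
  simp only [Finset.sum_const, Finset.card_univ, Fintype.card_fin, smul_eq_mul] at this
  exact_mod_cast this

/-- Starts the invariant of the search: `2^⌈4L⌉ ≥ exp (2L) = (n/δ)² ≥ n²`, and `d_avg ≤ n`. -/
theorem avgDeg_half_lt (hδ : 0 < δ) (hδ1 : δ < 1) [Nonempty G.Dart] :
    avgDeg G / 2 < 2 ^ (⌈4 * Real.log (n / δ)⌉₊ + 1) / n := by
  have hn2 : 2 ≤ n := two_le_card (G := G)
  have hn : (0 : ℝ) < n := by exact_mod_cast Nat.pos_of_neZero n
  have h1 := exp_two_mul_le_two_pow (Nat.le_ceil (4 * Real.log (n / δ)))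
  rw [two_mul, Real.exp_add, Real.exp_log (by positivity)] at h1
  have h2 : (n : ℝ) ≤ n / δ := by
    rw [le_div_iff₀ hδ]
    nlinarith
  have h3 : (n : ℝ) * n ≤ 2 ^ ⌈4 * Real.log (n / δ)⌉₊ := le_trans (by gcongr) h1
  have h4 := avgDeg_le (G := G)
  rw [lt_div_iff₀ hn, pow_succ]
  nlinarith

theorem estimate_bounds [Nonempty G.Dart] (hε2 : ε < 1 / 2)
    (h : (1 - ε) * avgDeg G ≤ d ∧ d ≤ avgDeg G) :
    avgDeg G / 2 ≤ d ∧ 1 / (n : ℝ) ≤ d ∧ d ≤ n := by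
  have hn : (0 : ℝ) < n := by exact_mod_cast Nat.pos_of_neZero n
  have h2 := two_div_le_avgDeg (G := G)
  have hpos : 0 < avgDeg G := lt_of_lt_of_le (by positivity) h2
  have h3 : avgDeg G / 2 ≤ d := by nlinarith [h.1]
  have h4 : 2 / (n : ℝ) = 2 * (1 / n) := by ring
  exact ⟨h3, by linarith, h.2.trans avgDeg_le⟩

theorem preprocess_correct [Nonempty G.Dart] {C : ℝ} (hC : 84 ≤ C) (hε : 0 < ε)
    (hε2 : ε < 1 / 2) (hδ : 0 < δ) (hδ1 : δ < 1) (hx : 1 < x) :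
    ENNReal.ofReal (1 - δ) ≤ (preprocess n ε δ x).prob A (Successful A program C ε x) := by
  have hn2 : 2 ≤ n := two_le_card (G := G)
  have hn : (0 : ℝ) < n := by exact_mod_cast Nat.pos_of_neZero n
  have hL : 0 < Real.log (n / δ) := by linarith [one_le_two_mul_log hn2 hδ hδ1]
  have hfail : (preprocess n ε δ x).prob A (fun o => ¬ Successful A program C ε x o) ≤
      ENNReal.ofReal δ := by
    calc _ ≤ _ := QueryAlg.prob_bind_le A _ _
          (fun o => ∃ d, o = some d ∧ (1 - ε) * avgDeg G ≤ d ∧ d ≤ avgDeg G) _ (by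
            rintro _ ⟨d, rfl, hd⟩
            obtain ⟨-, h1, h2⟩ := estimate_bounds hε2 hd
            exact buildData_correct A hε hε2 hL hx hC hd.1 hd.2 h1 h2)
      _ ≤ _ := add_le_add_left (searchEstimate_correct A hε hε2 hL _ (avgDeg_half_lt hδ hδ1)) _
      _ ≤ ENNReal.ofReal δ := by
          have h2 : (2⁻¹ : ℝ≥0∞) = ENNReal.ofReal (1 / 2) := by
            rw [one_div, ENNReal.ofReal_inv_of_pos two_pos]; simp
          refine le_trans (le_of_eq ?_) (ENNReal.ofReal_le_ofReal (failure_le hn2 hδ hδ1))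
          rw [ENNReal.ofReal_add (by positivity) (by positivity),
            ENNReal.ofReal_add (by positivity) (by positivity),
            ENNReal.ofReal_mul (Nat.cast_nonneg _), ENNReal.ofReal_mul (Nat.cast_nonneg _),
            ENNReal.ofReal_mul (Nat.cast_nonneg n), ENNReal.ofReal_natCast,
            ENNReal.ofReal_natCast, ENNReal.ofReal_natCast,
            ENNReal.ofReal_pow (by norm_num), h2]
  rw [ENNReal.ofReal_sub _ hδ.le, ENNReal.ofReal_one, tsub_le_iff_right,
    ← QueryAlg.prob_add_not A (preprocess n ε δ x) (Successful A program C ε x)]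
  exact add_le_add_right hfail _

theorem expectedQueries_preprocess_le [Nonempty G.Dart] (hε : 0 < ε)
    (hε2 : ε < 1 / 2) (hδ : 0 < δ) (hδ1 : δ < 1) (hx : 1 < x) :
    (preprocess n ε δ x).expectedQueries A ≤
      ENNReal.ofReal (100000000 * budget n ε (Real.log (n / δ)) x (avgDeg G)) := by
  have hn2 : 2 ≤ n := two_le_card (G := G)
  have hn : (0 : ℝ) < n := by exact_mod_cast Nat.pos_of_neZero n
  have hL1 := one_le_two_mul_log hn2 hδ hδ1
  have hexp := exp_neg_log hn2 hδ
  rw [preprocess]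
  have hK := avgDeg_half_lt (G := G) hδ hδ1
  set L := Real.log (n / δ)
  have hL : 0 < L := by linarith
  set R := ⌈4 * L⌉₊
  have hR : (R : ℝ) ≤ 4 * L + 1 := (Nat.ceil_lt_add_one (by linarith)).le
  have hd : 0 < avgDeg G := lt_of_lt_of_le (by positivity) (two_div_le_avgDeg (G := G))
  have hdn := avgDeg_le (G := G)
  set D := avgDeg G
  set E := 1 / ε ^ (5 / 2 : ℝ) with hEdef
  have hE : 1 ≤ E := one_le_inv_rpow hε (by linarith)
  set Z := max ((n : ℝ) / (D * x)) √((n : ℝ) / D) with hZdef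
  have hZs : √((n : ℝ) / D) ≤ Z := le_max_right _ _
  have hZ : 1 ≤ Z := (Real.one_le_sqrt.2 ((one_le_div hd).2 hdn)).trans hZs
  set z := Real.exp (-L) with hz
  have hz0 : 0 < z := Real.exp_pos _
  have hNz : n * z ≤ 1 := by rw [hexp]; field_simp; exact hδ1.le
  have hnp : 0 < n := Nat.pos_of_neZero n
  have hn1 : (1 : ℝ) ≤ n := by exact_mod_cast (by omega : 1 ≤ n)
  have hz1 : z ≤ 1 := by nlinarith
  have hLz : L * z ≤ 1 := by
    have h1 : L + 1 ≤ Real.exp L := Real.add_one_le_exp L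
    have h2 : Real.exp L * z = 1 := by rw [hz, ← Real.exp_add]; simp
    nlinarith
  have h10 : Real.exp (-(10 * L)) = z ^ 10 := by
    rw [hz, ← Real.exp_nat_mul]
    congr 1
    push_cast
    ring
  -- Absorbs the `+ 1` from rounding up into the main term, which adds 2 to each constant.
  have hone : ∀ B : ℝ, 1 ≤ B → 1 ≤ 2 * (L * B * E) := by
    intro B hB
    calc (1 : ℝ) = 1 * 1 * 1 := by norm_num
      _ ≤ 2 * L * B * E := by gcongr
      _ = _ := by ring
  have hq₁ : (sampleCount n ε L (D / 4) : ℝ) ≤ 245762 * (L * Z * E) := by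
    -- The guess `D/4` gives `32 · 4 = 128 ≤ 12²`; for the guess `1/n` below, `32 ≤ 6²`.
    have h := sampleCount_le (n := n) hε hL.le (show 0 < D / 4 by positivity)
      (show (0 : ℝ) ≤ 12 by norm_num) (r := Z) (by linarith) (by
        calc 32 * (n : ℝ) / (D / 4) = 128 * √((n : ℝ) / D) ^ 2 := by
              rw [Real.sq_sqrt (by positivity)]; field_simp; norm_num
          _ ≤ 144 * Z ^ 2 := by gcongr; norm_num
          _ = _ := by ring)
    have := hone Z hZ
    linarith
  have hq₂ : (sampleCount n ε L (1 / n) : ℝ) ≤ 122882 * (L * n * E) := by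
    have h := sampleCount_le (n := n) hε hL.le (show 0 < 1 / (n : ℝ) by positivity)
      (show (0 : ℝ) ≤ 6 by norm_num) (r := n) hn.le (by
        calc 32 * (n : ℝ) / (1 / n) = 32 * (n : ℝ) ^ 2 := by field_simp
          _ ≤ 36 * (n : ℝ) ^ 2 := by gcongr; norm_num
          _ = _ := by ring)
    have := hone n hn1
    linarith
  set s₁ : ℕ := ⌊322 * (L * Z * E)⌋₊
  set s₂ : ℕ := ⌊162 * (L * n ^ 2 * E)⌋₊
  have hs₁ : (s₁ : ℝ) ≤ 322 * (L * Z * E) := Nat.floor_le (by positivity)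
  have hs₂ : (s₂ : ℝ) ≤ 162 * (L * n ^ 2 * E) := Nat.floor_le (by positivity)
  have hgood : ∀ o : Option ℝ, (∃ d, o = some d ∧ (1 - ε) * D ≤ d ∧ d ≤ D) →
      (o.elim (.ret none) fun d => buildData n ε L x d : QueryAlg n _).expectedQueries A ≤
        R * (s₁ * 2) := by
    rintro _ ⟨d, rfl, hd'⟩
    obtain ⟨h1, -, -⟩ := estimate_bounds hε2 hd'
    refine (expectedQueries_buildData_le A ε L x d).trans ?_
    gcongr
    refine Nat.le_floor ?_
    have h := sampleSize_le hε (by linarith) hL.le (by linarith) (by linarith) hnp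
      (div_cappedTradeoff_le hx hnp hd h1)
    have := hone Z hZ
    linarith
  have hall : ∀ o : Option ℝ,
      (o.elim (.ret none) fun d => buildData n ε L x d : QueryAlg n _).expectedQueries A ≤
        R * (s₂ * 2) := by
    rintro (_ | d)
    · exact zero_le
    · by_cases h : 1 / n ≤ d ∧ d ≤ n
      · have hd0 : 0 < d := lt_of_lt_of_le (by positivity) h.1
        refine (expectedQueries_buildData_le A ε L x d).trans ?_
        gcongr
        refine Nat.le_floor ?_
        have h := sampleSize_le hε (by linarith) hL.le hd0 (by linarith) hnp
          (div_cappedTradeoff_le_sq hx hnp h.1 h.2)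
        have := hone ((n : ℝ) ^ 2) (one_le_pow₀ hn1)
        linarith
      · simp only [Option.elim_some, buildData, if_neg h]
        exact zero_le
  refine (QueryAlg.expectedQueries_bind_le A _ _ _ hgood hall).trans ((add_le_add
    (expectedQueries_searchEstimate_le A hε hε2 hL _ _ le_rfl hK) (add_le_add_left
      (mul_le_mul_right (searchEstimate_correct A hε hε2 hL _ hK) _) _)).trans ?_)
  have htotal := total_le (R := (R : ℝ)) hL1 hZ hE hz0.le hz1 hn.le hLz hNz
    (Nat.cast_nonneg (R + 1)) (Nat.cast_nonneg _) (Nat.cast_nonneg _) (Nat.cast_nonneg s₁)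
    (Nat.cast_nonneg s₂) (by linarith) (by push_cast; linarith) hq₁ hq₂ hs₁ hs₂
  refine le_trans (le_of_eq ?_) (ENNReal.ofReal_le_ofReal (htotal.trans (le_of_eq ?_)))
  · rw [h10]
    have hρ : (0 : ℝ) ≤ 2 * z ^ 10 := by positivity
    generalize 2 * z ^ 10 = ρ at hρ
    simp (disch := positivity) only [ENNReal.ofReal_add, ENNReal.ofReal_mul,
      ENNReal.ofReal_natCast, ENNReal.ofReal_ofNat]
    rfl
  · rw [budget, hEdef]
    ring

end EdgeSampler

end

theorem mainTheorem1 :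
    ∃ (pre : (n : ℕ) → (ε δ x : ℝ) → QueryAlg n (Option (ℝ × List ℝ))) (samp : Program) (C : ℝ),
      0 < C ∧
      ∀ (n : ℕ) [NeZero n] (G : SimpleGraph (Fin n)) [DecidableRel G.Adj] [Nonempty G.Dart]
        (A : AdjList G) (ε δ x : ℝ), 0 < ε → ε < 1 / 2 → 0 < δ → δ < 1 → 1 < x →
        (pre n ε δ x).expectedQueries A ≤
          ENNReal.ofReal (C * (max ((n : ℝ) / (avgDeg G * x)) √((n : ℝ) / avgDeg G) *
            (Real.log ((n : ℝ) / δ) ^ 2 / ε ^ (5 / 2 : ℝ)))) ∧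
        ENNReal.ofReal (1 - δ) ≤
          ((pre n ε δ x).output A).toOuterMeasure {o | Successful A samp C ε x o} := by
  refine ⟨EdgeSampler.preprocess, EdgeSampler.program, 100000000, by norm_num, ?_⟩
  intro n _ G _ _ A ε δ x hε hε2 hδ hδ1 hx
  exact ⟨EdgeSampler.expectedQueries_preprocess_le A hε hε2 hδ hδ1 hx,
    EdgeSampler.preprocess_correct A (by norm_num) hε hε2 hδ hδ1 hx⟩
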